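/- Let $K$ be a quadratic number field with ring of integers $\mathcal{O}_K$ and discriminant $d_K$, let $f$ be a positive integer, and let $\mathcal{O}\subseteq\mathcal{O}_K$ be the order in $K$ with conductor $\{x\in\mathcal{O}_K : x\mathcal{O}_K\subseteq\mathcal{O}\}=f\mathcal{O}_K$, where $$(f,d_K)\in\{(2,60),(3,60),(5,60),(6,60),(10,60),(15,60),(30,60),(10,85),(35,40),(195,65),(30,365)\}.$$ A prime number $p$ is called inert if $p\mathcal{O}_K$ is a prime ideal, and ramified if $p\mathcal{O}_K$ is the square of a prime ideal. For a nonzero $a\in\mathcal{O}$ let $\mathsf{L}(a)$ be the set of all $n\ge 0$ such that $a$ is, up to a unit, a product of $n$ irreducible elements of $\mathcal{O}$, and let $\Delta(\mathcal{O})$ be the set of all $d\ge 1$ for which there are a nonzero $a\in\mathcal{O}$ and $k\in\mathsf{L}(a)$ with $\mathsf{L}(a)\cap[k,k+d]=\{k,k+d\}$. Then: 1. If $(f,d_K)\in\{(2,60),(3,60),(5,60)\}$, then $f$ is a ramified prime. 2. If $(f,d_K)\in\{(6,60),(10,60),(15,60)\}$, then $f$ is the product of two distinct ramified primes. 3. If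 $(f,d_K)=(30,60)$, then $f$ is the product of three distinct ramified primes. 4. If $(f,d_K)\in\{(10,85),(35,40)\}$, then $f$ is the product of an inert prime and a ramified prime. 5. If $(f,d_K)=(195,65)$, then $f$ is the product of an inert prime and two distinct ramified primes. 6. If $(f,d_K)=(30,365)$, then $f$ is the product of two distinct inert primes and a ramified prime. 7. $\Delta(\mathcal{O})$ is nonempty and $\min\Delta(\mathcal{O})=2$. -/

import Mathlib

open scoped NumberField nonZeroDivisors

namespace QuadOrder

section Lengths

/-- The factorization monoid `Z(H)` of a commutative monoid `H`: the free abelian monoid whose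
basis is the set of atoms of the reduced monoid `H_red = Associates H`. -/
abbrev FactorizationMonoid (H : Type*) [CommMonoid H] : Type _ :=
  Multiset {u : Associates H // Irreducible u}

/-- The factorization homomorphism `π : Z(H) → H_red`. -/
def factorizationHom (H : Type*) [CommMonoid H] (z : FactorizationMonoid H) : Associates H :=
  (z.map Subtype.val).prod

/-- The set of factorizations `Z(a)` of an element `a`. -/
def factorizations {H : Type*} [CommMonoid H] (a : H) : Set (FactorizationMonoid H) :=
  {z | factorizationHom H z = Associates.mk a}

/-- The set of lengths `L(a)` of an element `a`. -/
def setOfLengths {H : Type*} [CommMonoid H] (a : H) : Set ℕ :=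
  {n | ∃ z ∈ factorizations a, Multiset.card z = n}

/-- The set of distances `Δ(L)` of a set of nonnegative integers. -/
def distances (L : Set ℕ) : Set ℕ :=
  {d | 0 < d ∧ ∃ k ∈ L, L ∩ Set.Icc k (k + d) = {k, k + d}}

/-- The set of distances `Δ(H)` of a commutative monoid `H`. -/
def distancesOfMonoid (H : Type*) [CommMonoid H] : Set ℕ :=
  ⋃ a : H, distances (setOfLengths a)

/-- The set of distances `Δ(R)` of a domain `R`, i.e. of its multiplicative monoid of nonzero
elements (which are exactly the non-zero-divisors). -/
def distancesOfDomain (R : Type*) [CommRing R] [IsDomain R] : Set ℕ :=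
  distancesOfMonoid R⁰

end Lengths

section Orders

variable (K : Type*) [Field K] [NumberField K]

variable {K} in
/-- A subring `O` of `𝓞 K` is an order if its quotient field is `K` and `𝓞 K` is a finitely
generated `O`-module. -/
structure IsOrder (O : Subring (𝓞 K)) : Prop where
  isFractionRing : IsFractionRing O K
  finite : Module.Finite O (𝓞 K)

variable {K} in
/-- The conductor `(O : 𝓞 K) = {x | x 𝓞 K ⊆ O}`, as an ideal of `𝓞 K`. -/
def orderConductor (O : Subring (𝓞 K)) : Ideal (𝓞 K) where
  carrier := {x | ∀ y : 𝓞 K, x * y ∈ O}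
  zero_mem' y := by simp [O.zero_mem]
  add_mem' ha hb y := by simpa only [add_mul] using O.add_mem (ha y) (hb y)
  smul_mem' c x hx y := by
    simpa only [smul_eq_mul, mul_left_comm, mul_assoc] using hx (c * y)

/-- A prime number `p` is inert in `K` if `p 𝓞 K` is a prime ideal. -/
def IsInertPrime (p : ℕ) : Prop :=
  p.Prime ∧ (Ideal.span {(p : 𝓞 K)}).IsPrime

/-- A prime number `p` is ramified in the quadratic field `K` if `p 𝓞 K` is the square of a
prime ideal. -/
def IsRamifiedPrime (p : ℕ) : Prop :=
  p.Prime ∧ ∃ P : Ideal (𝓞 K), P.IsPrime ∧ Ideal.span {(p : 𝓞 K)} = P ^ 2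

end Orders

end QuadOrder

/-! In each case the class group of `𝓞 K` has at most two elements, `f` is squarefree, and every
prime dividing `f` is inert or the square of a nonprincipal prime. Give each prime ideal a weight
modulo 4: 2 if it is principal, and otherwise 3 or 1 according to whether or not it lies above a
prime divisor of `f`. Extend this additively to nonzero ideals.

Every atom of `O` has weight 2 (`idealWeight_eq_two_of_irreducible`). An element of `O` generates an
admissible ideal, and such an ideal, if principal and proper, splits off a principal admissible
divisor of weight 2 with admissible cofactor (`Admissible.exists_isPrincipal_mul`). Generators of
the two factors need not lie in `O`. However, for `p ∣ f` the powers of one unit `E` exhaust the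
units modulo `p` up to integers, and the orders of these groups are pairwise coprime, so by the
Chinese remainder theorem a power of `E` moves both generators into `O` (`exists_pow_mul_of_mul`).
An atom is therefore associated to the factor of weight 2.

Consequently twice the length of a factorization is determined modulo 4 by the element, and all
distances are even. The distance 2 occurs: if `x ∈ O` has norm `± p ^ 3 * q` with `p ∣ f`, and
neither `p` nor `q` is up to sign a norm, then `x`, its conjugate, `p` and `q` are atoms, and `x *
conj x = ± p * p * p * q` has lengths 2 and 4 (`two_mem_setOfLengths_and_four_mem`). -/

namespace QuadOrder

/-! ### Coordinates, norm form and conjugation for a quadratic integral basis. -/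

/-- A basis `1, ω` of a commutative ring `R` over `ℤ`, together with the relation
`ω ^ 2 = t ω + m`. -/
structure QuadraticBasis (R : Type*) [CommRing R] (t m : ℤ) where
  /-- the underlying basis -/
  basis : Module.Basis (Fin 2) ℤ R
  basis_zero : basis 0 = 1
  basis_one_mul_self : basis 1 * basis 1 = t * basis 1 + m

namespace QuadraticBasis

section Coordinates

variable {R : Type*} [CommRing R] {t m : ℤ}

/-- The second basis vector `ω`. -/
noncomputable def gen (B : QuadraticBasis R t m) : R := B.basis 1

/-- The coordinate at `1`. -/
noncomputable def re (B : QuadraticBasis R t m) (x : R) : ℤ := B.basis.repr x 0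

/-- The coordinate at `ω`. -/
noncomputable def im (B : QuadraticBasis R t m) (x : R) : ℤ := B.basis.repr x 1

variable (B : QuadraticBasis R t m)

theorem gen_mul_self : B.gen * B.gen = t * B.gen + m := B.basis_one_mul_self

theorem eq_re_add_im (x : R) : x = B.re x + B.im x * B.gen := by
  conv_lhs => rw [← B.basis.sum_repr x]
  simp [Fin.sum_univ_two, B.basis_zero, re, im, gen]

@[simp]
theorem re_add_mul_gen (a b : ℤ) : B.re (a + b * B.gen) = a := by
  have : (a + b * B.gen : R) = a • B.basis 0 + b • B.basis 1 := by simp [B.basis_zero, gen]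
  rw [this]
  simp [re, -zsmul_eq_mul]

@[simp]
theorem im_add_mul_gen (a b : ℤ) : B.im (a + b * B.gen) = b := by
  have : (a + b * B.gen : R) = a • B.basis 0 + b • B.basis 1 := by simp [B.basis_zero, gen]
  rw [this]
  simp [im, -zsmul_eq_mul]

theorem ext_coord {x y : R} (h₀ : B.re x = B.re y) (h₁ : B.im x = B.im y) : x = y := by
  rw [B.eq_re_add_im x, B.eq_re_add_im y, h₀, h₁]

theorem mul_eq (x y : R) : x * y =
    ((B.re x * B.re y + m * (B.im x * B.im y) : ℤ) : R) +
      ((B.re x * B.im y + B.im x * B.re y + t * (B.im x * B.im y) : ℤ) : R) * B.gen := by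
  conv_lhs => rw [B.eq_re_add_im x, B.eq_re_add_im y]
  push_cast
  linear_combination (B.im x : R) * B.im y * B.gen_mul_self

theorem re_mul (x y : R) : B.re (x * y) = B.re x * B.re y + m * (B.im x * B.im y) := by
  rw [B.mul_eq, re_add_mul_gen]

theorem im_mul (x y : R) :
    B.im (x * y) = B.re x * B.im y + B.im x * B.re y + t * (B.im x * B.im y) := by
  rw [B.mul_eq, im_add_mul_gen]

@[simp]
theorem re_intCast (a : ℤ) : B.re (a : R) = a := by
  simpa using B.re_add_mul_gen a 0

@[simp]
theorem im_intCast (a : ℤ) : B.im (a : R) = 0 := by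
  simpa using B.im_add_mul_gen a 0

@[simp]
theorem re_natCast (a : ℕ) : B.re (a : R) = a := by
  simpa using B.re_intCast a

@[simp]
theorem im_natCast (a : ℕ) : B.im (a : R) = 0 := by
  simpa using B.im_intCast a

@[simp]
theorem re_one : B.re 1 = 1 := by simpa using B.re_intCast 1

@[simp]
theorem im_one : B.im 1 = 0 := by simpa using B.im_intCast 1

@[simp]
theorem re_gen : B.re B.gen = 0 := by simpa using B.re_add_mul_gen 0 1

@[simp]
theorem im_gen : B.im B.gen = 1 := by simpa using B.im_add_mul_gen 0 1

theorem im_intCast_mul (a : ℤ) (x : R) : B.im (a * x) = a * B.im x := by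
  simp [im_mul]

theorem intCast_dvd_iff (n : ℤ) (x : R) : (n : R) ∣ x ↔ n ∣ B.re x ∧ n ∣ B.im x := by
  constructor
  · rintro ⟨y, rfl⟩
    simp [re_mul, im_mul]
  · rintro ⟨⟨a, ha⟩, ⟨b, hb⟩⟩
    refine ⟨a + b * B.gen, ?_⟩
    rw [B.eq_re_add_im x, ha, hb]
    push_cast
    ring

/-- The norm form `a ^ 2 + t a b - m b ^ 2`. -/
noncomputable def normForm (x : R) : ℤ := B.re x ^ 2 + t * (B.re x * B.im x) - m * B.im x ^ 2

/-- The conjugate of an element. -/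
noncomputable def conj (x : R) : R := ((B.re x + t * B.im x : ℤ) : R) + ((-B.im x : ℤ) : R) * B.gen

@[simp]
theorem re_conj (x : R) : B.re (B.conj x) = B.re x + t * B.im x := B.re_add_mul_gen _ _

@[simp]
theorem im_conj (x : R) : B.im (B.conj x) = -B.im x := B.im_add_mul_gen _ _

theorem mul_conj (x : R) : x * B.conj x = (B.normForm x : R) := by
  apply B.ext_coord
  · rw [re_mul, re_conj, im_conj, re_intCast, normForm]
    ring
  · rw [im_mul, re_conj, im_conj, im_intCast]
    ring

theorem normForm_conj (x : R) : B.normForm (B.conj x) = B.normForm x := by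
  simp only [normForm, re_conj, im_conj]
  ring

theorem normForm_mul (x y : R) : B.normForm (x * y) = B.normForm x * B.normForm y := by
  simp only [normForm, re_mul, im_mul]
  ring

theorem normForm_natCast (a : ℕ) : B.normForm (a : R) = (a : ℤ) ^ 2 := by
  simp [normForm]

theorem normForm_one : B.normForm (1 : R) = 1 := by
  simp [normForm]

theorem normForm_add_mul_gen (a b : ℤ) :
    B.normForm (a + b * B.gen) = a ^ 2 + t * (a * b) - m * b ^ 2 := by
  simp [normForm]

theorem norm_eq_normForm (x : R) : Algebra.norm ℤ x = B.normForm x := by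
  rw [Algebra.norm_eq_matrix_det B.basis, Matrix.det_fin_two]
  simp only [Algebra.leftMulMatrix_eq_repr_mul]
  change B.re (x * B.basis 0) * B.im (x * B.gen) - B.re (x * B.gen) * B.im (x * B.basis 0) = _
  rw [B.basis_zero]
  simp only [re_mul, im_mul, re_gen, im_gen, mul_one, normForm]
  ring

theorem trace_eq (x : R) : Algebra.trace ℤ R x = 2 * B.re x + t * B.im x := by
  rw [Algebra.trace_eq_matrix_trace B.basis, Matrix.trace_fin_two]
  simp only [Algebra.leftMulMatrix_eq_repr_mul]
  change B.re (x * B.basis 0) + B.im (x * B.gen) = _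
  rw [B.basis_zero]
  simp only [im_mul, re_gen, im_gen, mul_one]
  ring

theorem discr_eq : Algebra.discr ℤ B.basis = t ^ 2 + 4 * m := by
  have h : ∀ i j, Algebra.traceMatrix ℤ B.basis i j = Algebra.trace ℤ R (B.basis i * B.basis j) :=
    fun i j ↦ rfl
  rw [Algebra.discr_def, Matrix.det_fin_two, h, h, h, h, B.basis_zero]
  change _ * Algebra.trace ℤ R (B.gen * B.gen) - Algebra.trace ℤ R (1 * B.gen) *
    Algebra.trace ℤ R (B.gen * 1) = _
  simp only [B.trace_eq, one_mul, mul_one, re_mul, im_mul, re_gen, im_gen, re_one, im_one]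
  ring

theorem isUnit_of_normForm {x : R} (h : IsUnit (B.normForm x)) : IsUnit x := by
  have := h.map (Int.castRingHom R)
  rw [eq_intCast, ← B.mul_conj] at this
  exact isUnit_of_mul_isUnit_left this

theorem isUnit_normForm {x : R} (h : IsUnit x) : IsUnit (B.normForm x) := by
  obtain ⟨y, hy⟩ := h.exists_right_inv
  refine IsUnit.of_mul_eq_one (B.normForm y) ?_
  rw [← normForm_mul, hy, normForm_one]

/-- The basis attached to an element `ω` for which every element is uniquely `a + b ω`. -/
noncomputable def ofGenerator (ω : R) (hli : ∀ a b : ℤ, (a + b * ω : R) = 0 → a = 0 ∧ b = 0)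
    (hspan : ∀ x : R, ∃ a b : ℤ, x = a + b * ω) (hω : ω * ω = t * ω + m) :
    QuadraticBasis R t m where
  basis := Module.Basis.mk (v := ![1, ω])
    (LinearIndependent.pair_iff.mpr fun a b h ↦ hli a b (by simpa using h))
    (fun x _ ↦ by
      obtain ⟨a, b, rfl⟩ := hspan x
      rw [Matrix.range_cons, Matrix.range_cons, Matrix.range_empty, Set.union_empty,
        Set.singleton_union, Submodule.mem_span_pair]
      exact ⟨a, b, by simp⟩)
  basis_zero := by simp
  basis_one_mul_self := by simpa using hω

/-- Replacing `ω` by `ω + c`. -/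
noncomputable def shift (c : ℤ) : QuadraticBasis R (t + 2 * c) (m - c * t - c ^ 2) :=
  ofGenerator (B.gen + c)
    (fun a b h ↦ by
      have h' : ((a + b * c : ℤ) : R) + (b : R) * B.gen = 0 := by
        rw [← h]
        push_cast
        ring
      have h₀ := congrArg B.re h'
      have h₁ := congrArg B.im h'
      rw [re_add_mul_gen] at h₀
      rw [im_add_mul_gen] at h₁
      have h₂ : b = 0 := by simpa [im] using h₁
      subst h₂
      exact ⟨by simpa [re] using h₀, rfl⟩)
    (fun x ↦ ⟨B.re x - B.im x * c, B.im x, by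
      conv_lhs => rw [B.eq_re_add_im x]
      push_cast
      ring⟩)
    (by
      push_cast
      linear_combination B.gen_mul_self)

end Coordinates

/-! ### Integral bases of the form `1, ω` and the discriminant. -/

section NumberField

variable {K : Type*} [Field K] [NumberField K] {t m : ℤ}

theorem discr_numberField (B : QuadraticBasis (𝓞 K) t m) :
    NumberField.discr K = t ^ 2 + 4 * m := by
  rw [← B.discr_eq, NumberField.discr_eq_discr]

/-- The vector 1 is primitive in any integral basis: if `g` divides both of its coordinates then `g`
divides 1 in `𝓞 K`, and taking norms `g ^ 2 ∣ 1`. A Bézout relation between the coordinates then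
completes 1 to a basis. -/
theorem exists_of_finrank_eq_two (hK : Module.finrank ℚ K = 2) :
    ∃ t m : ℤ, Nonempty (QuadraticBasis (𝓞 K) t m) := by
  have hr : Module.finrank ℤ (𝓞 K) = 2 := by rw [NumberField.RingOfIntegers.rank, hK]
  let b := Module.finBasisOfFinrankEq ℤ (𝓞 K) hr
  have hb : ∀ x : 𝓞 K, x = b.repr x 0 * b 0 + b.repr x 1 * b 1 := fun x ↦ by
    conv_lhs => rw [← b.sum_repr x]
    simp [Fin.sum_univ_two]
  have hbli : ∀ p q : ℤ, (p * b 0 + q * b 1 : 𝓞 K) = 0 → p = 0 ∧ q = 0 := fun p q h ↦ by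
    have h' : p • b 0 + q • b 1 = 0 := by simpa using h
    have h₀ := congrArg (fun x ↦ b.repr x 0) h'
    have h₁ := congrArg (fun x ↦ b.repr x 1) h'
    exact ⟨by simpa [-zsmul_eq_mul] using h₀, by simpa [-zsmul_eq_mul] using h₁⟩
  set u := b.repr 1 0 with hu
  set v := b.repr 1 1 with hv
  have h1 : (1 : 𝓞 K) = u * b 0 + v * b 1 := hb 1
  have huv : IsCoprime u v := by
    rw [Int.isCoprime_iff_gcd_eq_one]
    obtain ⟨u', hu'⟩ := Int.gcd_dvd_left u v
    obtain ⟨v', hv'⟩ := Int.gcd_dvd_right u v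
    generalize Int.gcd u v = g at hu' hv'
    have hd : ((g : ℤ) : 𝓞 K) * (u' * b 0 + v' * b 1) = 1 := by
      rw [h1, hu', hv']
      push_cast
      ring
    have hn := congrArg (Algebra.norm ℤ) hd
    rw [map_mul, map_one (Algebra.norm ℤ), ← eq_intCast (algebraMap ℤ (𝓞 K)),
      Algebra.norm_algebraMap_of_basis b, Fintype.card_fin, sq, mul_assoc] at hn
    have := Int.isUnit_iff.mp (IsUnit.of_mul_eq_one _ hn)
    omega
  obtain ⟨r, s, hrs⟩ := huv
  have hrs' : (r * u + s * v : 𝓞 K) = 1 := by exact_mod_cast congrArg (Int.cast (R := 𝓞 K)) hrs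
  set ω : 𝓞 K := -s * b 0 + r * b 1 with hω
  have hspan : ∀ x : 𝓞 K, ∃ p q : ℤ, x = p + q * ω := fun x ↦ by
    refine ⟨b.repr x 0 * r + b.repr x 1 * s, -(b.repr x 0 * v) + b.repr x 1 * u, ?_⟩
    conv_lhs => rw [hb x]
    push_cast
    rw [hω]
    linear_combination (b.repr x 0 * r + b.repr x 1 * s : 𝓞 K) * h1.symm -
      (b.repr x 0 * b 0 + b.repr x 1 * b 1 : 𝓞 K) * hrs'
  obtain ⟨m, t, h⟩ := hspan (ω * ω)
  refine ⟨t, m, ⟨ofGenerator ω (fun p q h ↦ ?_) hspan (by rw [h, add_comm])⟩⟩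
  obtain ⟨h₀, h₁⟩ := hbli (p * u - q * s) (p * v + q * r) (by
    push_cast
    rw [← h, hω]
    linear_combination -(p : 𝓞 K) * h1)
  constructor
  · linear_combination r * h₀ + s * h₁ - p * hrs
  · linear_combination -v * h₀ + u * h₁ - q * hrs

/-- Two presentations with the same discriminant have `t ≡ t'` modulo 2, since their squares agree
modulo 4; a shift of `ω` by an integer takes one into the other. -/
theorem exists_of_discr (hK : Module.finrank ℚ K = 2) {t m : ℤ}
    (hd : NumberField.discr K = t ^ 2 + 4 * m) : Nonempty (QuadraticBasis (𝓞 K) t m) := by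
  obtain ⟨t', m', ⟨B⟩⟩ := exists_of_finrank_eq_two hK
  rw [B.discr_numberField] at hd
  have hpar : Even (t - t') := by
    have h : Even ((t - t') * (t + t')) := ⟨2 * (m' - m), by linear_combination -hd⟩
    grind
  obtain ⟨c, hc⟩ := hpar
  obtain rfl : t = t' + 2 * c := by linarith
  obtain rfl : m = m' - c * t' - c ^ 2 := by linarith
  exact ⟨B.shift c⟩

end NumberField

end QuadraticBasis

end QuadOrder

namespace QuadOrder

namespace QuadraticBasis

/-! ### Orders in coordinates. -/

section Order

variable {K : Type*} [Field K] {t m : ℤ} (B : QuadraticBasis (𝓞 K) t m)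

/-- A subring with conductor `f 𝓞 K` consists of the elements `a + b ω` with `f ∣ b`. -/
theorem mem_subring_iff {f : ℕ} {O : Subring (𝓞 K)}
    (hf : orderConductor O = Ideal.span {(f : 𝓞 K)}) (x : 𝓞 K) : x ∈ O ↔ (f : ℤ) ∣ B.im x := by
  -- Since `O` contains the integers, membership depends only on the coordinate at `ω`, which has to
  -- lie in an ideal `(g)` of `ℤ`. Then `g` lies in the conductor, so `f ∣ g`, and `f ω ∈ O` gives
  -- `g ∣ f`.
  let H : Ideal ℤ :=
    { carrier := {b | (b : 𝓞 K) * B.gen ∈ O}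
      zero_mem' := by simp [O.zero_mem]
      add_mem' := fun ha hb ↦ by simpa [add_mul] using O.add_mem ha hb
      smul_mem' := fun c x hx ↦ by simpa [mul_assoc] using O.mul_mem (intCast_mem O c) hx }
  have hH : ∀ b : ℤ, b ∈ H ↔ (b : 𝓞 K) * B.gen ∈ O := fun b ↦ Iff.rfl
  have hO : ∀ x, x ∈ O ↔ B.im x ∈ H := fun x ↦ by
    rw [hH]
    conv_lhs => rw [B.eq_re_add_im x]
    exact O.toAddSubgroup.add_mem_cancel_left (intCast_mem O _)
  obtain ⟨g, hg⟩ := IsPrincipalIdealRing.principal H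
  rw [Ideal.submodule_span_eq] at hg
  have hfg : (f : ℤ) ∣ g := by
    have hmem : (g : 𝓞 K) ∈ orderConductor O := fun y ↦ by
      rw [hO, im_intCast_mul, hg]
      exact Ideal.mul_mem_right _ _ (Ideal.mem_span_singleton_self g)
    rw [hf, Ideal.mem_span_singleton, ← Int.cast_natCast, B.intCast_dvd_iff] at hmem
    simpa using hmem.1
  have hfH : (f : ℤ) ∈ H := by
    have hmem : (f : 𝓞 K) ∈ orderConductor O := hf ▸ Ideal.mem_span_singleton_self _
    have := hmem B.gen
    rwa [hH, Int.cast_natCast]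
  rw [hO]
  constructor
  · intro h
    rw [hg, Ideal.mem_span_singleton] at h
    exact hfg.trans h
  · rintro ⟨c, hc⟩
    rw [hc]
    exact H.mul_mem_right c hfH

end Order

/-! ### Units modulo the primes dividing the conductor. -/

section Local

variable {R : Type*} [CommRing R] {t m : ℤ} (B : QuadraticBasis R t m)

theorem dvd_im_mul {n : ℤ} {x y : R} (hx : n ∣ B.im x) (hy : n ∣ B.im y) :
    n ∣ B.im (x * y) := by
  rw [im_mul]
  exact ((hy.mul_left _).add (hx.mul_right _)).add ((hx.mul_right _).mul_left _)

theorem dvd_im_pow {n : ℤ} {x : R} (hx : n ∣ B.im x) (k : ℕ) : n ∣ B.im (x ^ k) := by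
  induction k with
  | zero => simp
  | succ k ih =>
    rw [pow_succ]
    exact B.dvd_im_mul ih hx

theorem dvd_im_of_dvd {n : ℤ} {x : R} (hx : (n : R) ∣ x) (y : R) : n ∣ B.im (y * x) :=
  ((B.intCast_dvd_iff n _).mp (hx.mul_left y)).2

/-- Modulo `p`, the factor `y` is an integer, and it is nonzero because `p` does not divide its
norm; it can be cancelled. -/
theorem dvd_im_of_dvd_im_mul {p : ℤ} (hp : Prime p) {x y : R} (hy : p ∣ B.im y)
    (hN : ¬ p ∣ B.normForm y) (hxy : p ∣ B.im (x * y)) : p ∣ B.im x := by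
  have hre : ¬ p ∣ B.re y := fun h ↦ hN <| by
    rw [normForm]
    exact ((h.pow two_ne_zero).add ((hy.mul_left _).mul_left _)).sub
      ((hy.pow two_ne_zero).mul_left _)
  have h : p ∣ B.im x * B.re y := by
    have h := hxy.sub ((hy.mul_left (B.re x)).add ((hy.mul_left (B.im x)).mul_left t))
    have h' : B.im (x * y) - (B.re x * B.im y + t * (B.im x * B.im y)) = B.im x * B.re y := by
      rw [im_mul]
      ring
    rwa [h'] at h
  exact (hp.dvd_or_dvd h).resolve_right hre

theorem not_dvd_normForm_of_isCoprime {p : ℤ} (hp : Prime p) {x : R}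
    (h : IsCoprime x (p : R)) : ¬ p ∣ B.normForm x := by
  intro hN
  have h₁ : (p : R) ∣ x * B.conj x := by
    rw [mul_conj]
    exact Int.cast_dvd_cast _ _ hN
  have h₂ := (B.intCast_dvd_iff p _).mp (h.symm.dvd_of_dvd_mul_left h₁)
  rw [re_conj, im_conj, dvd_neg] at h₂
  have h₃ : (p : R) ∣ x :=
    (B.intCast_dvd_iff p _).mpr ⟨(dvd_add_left (h₂.2.mul_left t)).mp h₂.1, h₂.2⟩
  obtain ⟨u, v, huv⟩ := h
  have h₄ : (p : R) ∣ 1 := huv ▸ (h₃.mul_left u).add (dvd_mul_left _ v)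
  have h₅ := ((B.intCast_dvd_iff p _).mp h₄).1
  rw [re_one] at h₅
  exact hp.not_isUnit (isUnit_of_dvd_one h₅)

/-- The powers of the unit `E` represent all classes of units modulo `p` up to integers, and the
order of this group of classes divides `n`. -/
structure RepresentsUnits (E : R) (p n : ℕ) : Prop where
  dvd_im_pow : (p : ℤ) ∣ B.im (E ^ n)
  exists_lt : ∀ x : R, ¬ (p : ℤ) ∣ B.normForm x → ∃ k < n, (p : ℤ) ∣ B.im (E ^ k * x)

variable {B} {E E' : R}

theorem RepresentsUnits.exists_modEq {p n : ℕ} (h : B.RepresentsUnits E p n) {x : R}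
    (hx : ¬ (p : ℤ) ∣ B.normForm x) :
    ∃ k₀ < n, ∀ k, k ≡ k₀ [MOD n] → (p : ℤ) ∣ B.im (E ^ k * x) := by
  obtain ⟨k₀, hk₀, hd⟩ := h.exists_lt x hx
  refine ⟨k₀, hk₀, fun k hk ↦ ?_⟩
  have hk' : k % n = k₀ := by rw [hk, Nat.mod_eq_of_lt hk₀]
  have : E ^ k * x = (E ^ n) ^ (k / n) * (E ^ k₀ * x) := by
    rw [← pow_mul, ← mul_assoc, ← pow_add, ← hk', Nat.div_add_mod]
  rw [this]
  exact B.dvd_im_mul (B.dvd_im_pow h.dvd_im_pow _) hd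

theorem RepresentsUnits.exists_modEq_inv {p n : ℕ} (hp : p.Prime) (h : B.RepresentsUnits E p n)
    (hE : E * E' = 1) {x : R} (hx : ¬ (p : ℤ) ∣ B.normForm x) :
    ∃ k₀, ∀ k, k ≡ k₀ [MOD n] → (p : ℤ) ∣ B.im (E' ^ k * x) := by
  obtain ⟨k₀, hk₀, hd⟩ := h.exists_lt x hx
  -- For such `k` the exponent `k + k₀` is a multiple of `n`, so `E' ^ (k + k₀)` is an integer
  -- modulo `p` and `E' ^ k` acts like `E ^ k₀` up to integers.
  refine ⟨n - k₀, fun k hk ↦ ?_⟩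
  have hdvd : n ∣ k + k₀ := by
    rw [← Nat.modEq_zero_iff_dvd]
    refine (hk.add_right k₀).trans ?_
    rw [Nat.sub_add_cancel hk₀.le]
    simp [Nat.ModEq]
  obtain ⟨j, hj⟩ := hdvd
  have hEk : (p : ℤ) ∣ B.im (E ^ (k + k₀)) := by
    rw [hj, pow_mul]
    exact B.dvd_im_pow h.dvd_im_pow _
  have hp' := Nat.prime_iff_prime_int.mp hp
  have hE'k : (p : ℤ) ∣ B.im (E' ^ (k + k₀)) := by
    refine B.dvd_im_of_dvd_im_mul hp' hEk (fun hN ↦ ?_) ?_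
    · exact hp'.not_isUnit (isUnit_of_dvd_unit hN
        (B.isUnit_normForm ((IsUnit.of_mul_eq_one _ hE).pow _)))
    · rw [← mul_pow, mul_comm E' E, hE, one_pow, im_one]
      exact dvd_zero _
  have : E' ^ k * x = E' ^ (k + k₀) * (E ^ k₀ * x) := by
    rw [pow_add, mul_assoc, ← mul_assoc (E' ^ k₀), ← mul_pow, mul_comm E' E, hE, one_pow, one_mul]
  rw [this]
  exact B.dvd_im_mul hE'k hd

theorem intCast_dvd_of_squarefree {f : ℕ} (hf : Squarefree f) {z : ℤ}
    (h : ∀ p ∈ f.primeFactors, (p : ℤ) ∣ z) : (f : ℤ) ∣ z := by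
  rw [Int.natCast_dvd, ← Nat.prod_primeFactors_of_squarefree hf]
  exact Finset.prod_primes_dvd _ (fun p hp ↦ (Nat.prime_of_mem_primeFactors hp).prime)
    fun p hp ↦ Int.natCast_dvd.mp (h p hp)

/-- If a product has coordinate at `ω` divisible by `f`, then the factors can be adjusted by a
power of `E` so that this also holds for them. -/
theorem exists_pow_mul_of_mul {f : ℕ} (hf : Squarefree f) (hE : E * E' = 1) (n : ℕ → ℕ)
    (hn : ∀ p ∈ f.primeFactors, B.RepresentsUnits E p (n p))
    (hcop : (f.primeFactors : Set ℕ).Pairwise (Function.onFun Nat.Coprime n)) {b c : R}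
    (hbc : (f : ℤ) ∣ B.im (b * c))
    (hb : ∀ p ∈ f.primeFactors, (p : R) ∣ b ∨ IsCoprime b (p : R))
    (hc : ∀ p ∈ f.primeFactors, (p : R) ∣ c ∨ IsCoprime c (p : R)) :
    ∃ k, (f : ℤ) ∣ B.im (E ^ k * b) ∧ (f : ℤ) ∣ B.im (E' ^ k * c) := by
  have key : ∀ p ∈ f.primeFactors, ∃ k₀, ∀ k, k ≡ k₀ [MOD n p] →
      (p : ℤ) ∣ B.im (E ^ k * b) ∧ (p : ℤ) ∣ B.im (E' ^ k * c) := by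
    intro p hp
    have hpp := Nat.prime_of_mem_primeFactors hp
    have hpz := Nat.prime_iff_prime_int.mp hpp
    have hbc' : (p : ℤ) ∣ B.im (b * c) :=
      (Int.natCast_dvd_natCast.mpr (Nat.dvd_of_mem_primeFactors hp)).trans hbc
    have hdb : (p : R) ∣ b → ∀ k, (p : ℤ) ∣ B.im (E ^ k * b) := fun h k ↦
      B.dvd_im_of_dvd (by simpa using h) _
    have hdc : (p : R) ∣ c → ∀ k, (p : ℤ) ∣ B.im (E' ^ k * c) := fun h k ↦
      B.dvd_im_of_dvd (by simpa using h) _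
    have hNb : IsCoprime b (p : R) → ¬ (p : ℤ) ∣ B.normForm b := fun h ↦
      B.not_dvd_normForm_of_isCoprime hpz (by simpa using h)
    have hNc : IsCoprime c (p : R) → ¬ (p : ℤ) ∣ B.normForm c := fun h ↦
      B.not_dvd_normForm_of_isCoprime hpz (by simpa using h)
    rcases hb p hp with h₁ | h₁
    · rcases hc p hp with h₂ | h₂
      · exact ⟨0, fun k _ ↦ ⟨hdb h₁ k, hdc h₂ k⟩⟩
      · obtain ⟨k₀, hk₀⟩ := (hn p hp).exists_modEq_inv hpp hE (hNc h₂)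
        exact ⟨k₀, fun k hk ↦ ⟨hdb h₁ k, hk₀ k hk⟩⟩
    · obtain ⟨k₀, -, hk₀⟩ := (hn p hp).exists_modEq (hNb h₁)
      -- The product of the adjusted factors is still `b * c`, so once the first is an invertible
      -- integer modulo `p`, the second is an integer modulo `p` as well.
      refine ⟨k₀, fun k hk ↦ ⟨hk₀ k hk, B.dvd_im_of_dvd_im_mul hpz (hk₀ k hk) ?_ ?_⟩⟩
      · rw [normForm_mul, hpz.dvd_mul, not_or]
        exact ⟨fun h ↦ hpz.not_isUnit (isUnit_of_dvd_unit h
          (B.isUnit_normForm ((IsUnit.of_mul_eq_one _ hE).pow _))), hNb h₁⟩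
      · have : E' ^ k * c * (E ^ k * b) = (E * E') ^ k * (b * c) := by
          rw [mul_pow]
          ring
        rwa [this, hE, one_pow, one_mul]
  choose! k₀ hk₀ using key
  have hn0 : ∀ p ∈ f.primeFactors, n p ≠ 0 := fun p hp h0 ↦ by
    obtain ⟨k, hk, -⟩ := (hn p hp).exists_lt 1 (by
      rw [normForm_one]
      exact fun h ↦ (Nat.prime_iff_prime_int.mp (Nat.prime_of_mem_primeFactors hp)).not_isUnit
        (isUnit_of_dvd_one h))
    omega
  obtain ⟨k, hk⟩ := Nat.chineseRemainderOfFinset k₀ n f.primeFactors hn0 hcop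
  exact ⟨k, intCast_dvd_of_squarefree hf fun p hp ↦ (hk₀ p hp k (hk p hp)).1,
    intCast_dvd_of_squarefree hf fun p hp ↦ (hk₀ p hp k (hk p hp)).2⟩

end Local

end QuadraticBasis

end QuadOrder

namespace QuadOrder

/-! ### Admissible ideals. -/

section Admissible

variable {R : Type*} [CommRing R]

/-- The ideals which are, for each prime `p ∣ f`, contained in `(p)` or coprime to `(p)`. -/
def Admissible (f : ℕ) (I : Ideal R) : Prop :=
  ∀ p ∈ f.primeFactors, I ≤ Ideal.span {(p : R)} ∨ IsCoprime I (Ideal.span {(p : R)})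

theorem Admissible.mul {f : ℕ} {I J : Ideal R} (hI : Admissible f I) (hJ : Admissible f J) :
    Admissible f (I * J) := fun p hp ↦ by
  rcases hI p hp with h | h
  · exact Or.inl (Ideal.mul_le_left.trans h)
  · rcases hJ p hp with h' | h'
    · exact Or.inl (Ideal.mul_le_right.trans h')
    · exact Or.inr (h.mul_left h')

theorem le_or_isCoprime_of_mul {S T J : Ideal R} (hS : IsCoprime S J)
    (h : S * T ≤ J ∨ IsCoprime (S * T) J) : T ≤ J ∨ IsCoprime T J := by
  refine h.imp (fun h ↦ ?_) IsCoprime.of_mul_left_right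
  rw [Ideal.isCoprime_iff_add] at hS
  calc T = (S + J) * T := by rw [hS, one_mul]
    _ = S * T + J * T := add_mul _ _ _
    _ ≤ J := sup_le h Ideal.mul_le_left

theorem isCoprime_of_notMem {M : Ideal R} (hM : M.IsMaximal) {x : R} (hx : x ∉ M) :
    IsCoprime M (Ideal.span {x}) := by
  rw [Ideal.isCoprime_iff_sup_eq]
  refine hM.1.2 _ (lt_of_le_of_ne le_sup_left fun h ↦ hx ?_)
  rw [h]
  exact Ideal.mem_sup_right (Ideal.mem_span_singleton_self x)

theorem isCoprime_span_natCast {p q : ℕ} (h : Nat.Coprime p q) :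
    IsCoprime (Ideal.span {(p : R)}) (Ideal.span {(q : R)}) := by
  rw [Ideal.isCoprime_span_singleton_iff]
  exact_mod_cast (Nat.isCoprime_iff_coprime.mpr h).intCast (R := R)

end Admissible

/-! ### Weights of ideals and splitting of admissible ideals. -/

section Weight

variable {R : Type*} [CommRing R] [IsDedekindDomain R]

open Classical in
/-- The weight of a prime ideal modulo `4`. -/
noncomputable def primeWeight (f : ℕ) (P : Ideal R) : ZMod 4 :=
  if P.IsPrincipal then 2 else if ∃ p ∈ f.primeFactors, (p : R) ∈ P then 3 else 1

/-- The additive extension of `primeWeight` to all nonzero ideals. -/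
noncomputable def idealWeight (f : ℕ) (I : Ideal R) : ZMod 4 :=
  ((UniqueFactorizationMonoid.normalizedFactors I).map (primeWeight f)).sum

theorem idealWeight_mul (f : ℕ) {I J : Ideal R} (hI : I ≠ ⊥) (hJ : J ≠ ⊥) :
    idealWeight f (I * J) = idealWeight f I + idealWeight f J := by
  rw [idealWeight, UniqueFactorizationMonoid.normalizedFactors_mul hI hJ, Multiset.map_add,
    Multiset.sum_add]
  rfl

theorem idealWeight_top (f : ℕ) : idealWeight f (⊤ : Ideal R) = 0 := by
  rw [← Ideal.one_eq_top, idealWeight, UniqueFactorizationMonoid.normalizedFactors_one]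
  simp

theorem idealWeight_prime (f : ℕ) {P : Ideal R} (hP : P ≠ ⊥) [P.IsPrime] :
    idealWeight f P = primeWeight f P := by
  rw [idealWeight, UniqueFactorizationMonoid.normalizedFactors_irreducible
    (Ideal.prime_of_isPrime hP inferInstance).irreducible]
  simp

theorem isPrincipal_of_span_singleton_mul {x : R} (hx : x ≠ 0) {I : Ideal R}
    (h : (Ideal.span {x} * I).IsPrincipal) : I.IsPrincipal := by
  obtain ⟨y, hy⟩ := h
  rw [Ideal.submodule_span_eq] at hy
  have hmem : y ∈ Ideal.span {x} * I := hy ▸ Ideal.mem_span_singleton_self y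
  obtain ⟨z, -, rfl⟩ := Ideal.mem_span_singleton_mul.mp hmem
  rw [← Ideal.span_singleton_mul_span_singleton] at hy
  exact ⟨z, mul_left_cancel₀ (by simpa using hx) hy⟩

/-- The prime divisors of `f` are nonzero and either remain prime, or become the square of a
nonprincipal prime. -/
def InertOrNonprincipal (R : Type*) [CommRing R] (f : ℕ) : Prop :=
  ∀ p ∈ f.primeFactors, (Ideal.span {(p : R)}).IsPrime ∨
    ∃ P : Ideal R, P.IsPrime ∧ Ideal.span {(p : R)} = P ^ 2 ∧ ¬ P.IsPrincipal

variable [CharZero R]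

-- A maximal ideal `M ⊇ I` is split off, enlarged where needed to keep both factors admissible. If
-- `M` avoids the primes dividing `f`, then `S = M`. Above an inert `p`, `S = (p)`. Above a ramified
-- `(p) = P ^ 2`, admissibility puts at least two factors `P` into `I`; the choice is `S = P ^ 3` if
-- there are exactly three, of weight `9 = 1`, and `S = P ^ 2` otherwise, of weight `6 = 2`.
open Classical in
theorem Admissible.exists_mul {f : ℕ} (hf : InertOrNonprincipal R f) {I : Ideal R} (hI : I ≠ ⊥)
    (hI' : I ≠ ⊤) (hadm : Admissible f I) :
    ∃ S T : Ideal R, I = S * T ∧ S ≠ ⊤ ∧ Admissible f S ∧ Admissible f T ∧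
      idealWeight f S = if S.IsPrincipal then 2 else 1 := by
  obtain ⟨M, hM, hIM⟩ := Ideal.exists_le_maximal I hI'
  have hM0 : M ≠ ⊥ := fun h ↦ hI (le_bot_iff.mp (h ▸ hIM))
  have hMp := hM.isPrime
  by_cases hp : ∃ p ∈ f.primeFactors, (p : R) ∈ M
  · obtain ⟨p, hpf, hpM⟩ := hp
    have hpp := Nat.prime_of_mem_primeFactors hpf
    have hp0 : (p : R) ≠ 0 := by exact_mod_cast hpp.ne_zero
    have hother : ∀ S : Ideal R, (∀ q ∈ f.primeFactors, q ≠ p →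
        IsCoprime (Ideal.span {(p : R)}) (Ideal.span {(q : R)}) →
        IsCoprime S (Ideal.span {(q : R)})) → ∀ T, I = S * T →
        (S ≤ Ideal.span {(p : R)}) →
        (T ≤ Ideal.span {(p : R)} ∨ IsCoprime T (Ideal.span {(p : R)})) →
        Admissible f S ∧ Admissible f T := by
      intro S hS T hST hSp hTp
      have hS' : ∀ q ∈ f.primeFactors, q ≠ p → IsCoprime S (Ideal.span {(q : R)}) :=
        fun q hq hqp ↦ hS q hq hqp (isCoprime_span_natCast
          ((Nat.coprime_primes hpp (Nat.prime_of_mem_primeFactors hq)).mpr hqp.symm))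
      refine ⟨fun q hq ↦ ?_, fun q hq ↦ ?_⟩
      · rcases eq_or_ne q p with rfl | hqp
        · exact Or.inl hSp
        · exact Or.inr (hS' q hq hqp)
      · rcases eq_or_ne q p with rfl | hqp
        · exact hTp
        · exact le_or_isCoprime_of_mul (hS' q hq hqp) (hST ▸ hadm q hq)
    have hIp : I ≤ Ideal.span {(p : R)} := by
      refine (hadm p hpf).resolve_right fun h ↦ hM.ne_top ?_
      rw [Ideal.isCoprime_iff_sup_eq] at h
      rw [eq_top_iff, ← h]
      exact sup_le hIM ((Ideal.span_singleton_le_iff_mem _).mpr hpM)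
    obtain ⟨T, hT⟩ := Ideal.dvd_iff_le.mpr hIp
    have hspan0 : Ideal.span {(p : R)} ≠ ⊥ := by simpa using hp0
    have hspanp : (Ideal.span {(p : R)}).IsPrincipal := ⟨p, rfl⟩
    have hspant : Ideal.span {(p : R)} ≠ ⊤ := fun h ↦ hM.ne_top <| by
      rw [eq_top_iff, ← h]
      exact (Ideal.span_singleton_le_iff_mem _).mpr hpM
    rcases hf p hpf with hin | ⟨P, hP, hPp, hPn⟩
    · have hmax : (Ideal.span {(p : R)}).IsMaximal := hin.isMaximal hspan0
      obtain ⟨hSa, hTa⟩ := hother _ (fun q _ _ h ↦ h) T hT le_rfl (by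
        by_cases h : T ≤ Ideal.span {(p : R)}
        · exact Or.inl h
        · refine Or.inr (IsCoprime.symm ?_)
          rw [Ideal.isCoprime_iff_sup_eq]
          exact hmax.1.2 _ (lt_of_le_of_ne le_sup_left fun he ↦ h (he ▸ le_sup_right)))
      refine ⟨_, T, hT, hspant, hSa, hTa, ?_⟩
      rw [idealWeight_prime f hspan0, primeWeight, if_pos hspanp, if_pos hspanp]
    · have hP0 : P ≠ ⊥ := by
        rintro rfl
        exact hspan0 (by rw [hPp]; simp)
      have hPmax := hP.isMaximal hP0
      have hpP : (p : R) ∈ P := by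
        refine Ideal.pow_le_self two_ne_zero ?_
        rw [← hPp]
        exact Ideal.mem_span_singleton_self _
      have hwP : idealWeight f P = 3 := by
        rw [idealWeight_prime f hP0, primeWeight, if_neg hPn, if_pos ⟨p, hpf, hpP⟩]
      have hwp : idealWeight f (Ideal.span {(p : R)}) = 2 := by
        rw [hPp, sq, idealWeight_mul f hP0 hP0, hwP]
        decide
      have hcop : ∀ U : Ideal R, ¬ U ≤ P → IsCoprime U (Ideal.span {(p : R)}) := fun U hU ↦ by
        rw [hPp]
        refine IsCoprime.pow_right (IsCoprime.symm ?_)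
        rw [Ideal.isCoprime_iff_sup_eq]
        exact hPmax.1.2 _ (lt_of_le_of_ne le_sup_left fun he ↦ hU (he ▸ le_sup_right))
      by_cases hTP : T ≤ P
      · obtain ⟨U, hU⟩ := Ideal.dvd_iff_le.mpr hTP
        by_cases hUP : U ≤ P
        · obtain ⟨hSa, hTa⟩ := hother _ (fun q _ _ h ↦ h) T hT le_rfl (Or.inl (by
            rw [hU, hPp, sq]
            exact Ideal.mul_mono_right hUP))
          refine ⟨_, T, hT, hspant, hSa, hTa, ?_⟩
          rw [hwp, if_pos hspanp]
        -- Here splitting off only `(p)` would leave `P * U`, which is neither contained in `(p)`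
        -- nor coprime to it.
        · have hIU : I = Ideal.span {(p : R)} * P * U := by rw [hT, hU, mul_assoc]
          obtain ⟨hSa, hTa⟩ := hother _ (fun q _ _ h ↦ h.mul_left (by
            rw [hPp] at h
            exact (IsCoprime.pow_left_iff two_pos).mp h)) U hIU Ideal.mul_le_left
              (Or.inr (hcop U hUP))
          refine ⟨_, U, hIU, fun h ↦ hspant (top_le_iff.mp ?_), hSa, hTa, ?_⟩
          · exact h.ge.trans Ideal.mul_le_left
          · rw [if_neg fun h ↦ hPn (isPrincipal_of_span_singleton_mul hp0 h),
              idealWeight_mul f hspan0 hP0, hwp, hwP]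
            decide
      · obtain ⟨hSa, hTa⟩ := hother _ (fun q _ _ h ↦ h) T hT le_rfl (Or.inr (hcop T hTP))
        refine ⟨_, T, hT, hspant, hSa, hTa, ?_⟩
        rw [hwp, if_pos hspanp]
  · push Not at hp
    obtain ⟨T, hT⟩ := Ideal.dvd_iff_le.mpr hIM
    have hcop : ∀ p ∈ f.primeFactors, IsCoprime M (Ideal.span {(p : R)}) :=
      fun p hpf ↦ isCoprime_of_notMem hM (hp p hpf)
    refine ⟨M, T, hT, hM.ne_top, fun p hpf ↦ Or.inr (hcop p hpf), fun p hpf ↦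
      le_or_isCoprime_of_mul (hcop p hpf) (hT ▸ hadm p hpf), ?_⟩
    rw [idealWeight_prime f hM0, primeWeight, if_neg (c := ∃ p ∈ f.primeFactors, (p : R) ∈ M)]
    rintro ⟨p, hpf, hpM⟩
    exact hp p hpf hpM

/-- If the product of two nonprincipal ideals is principal, every principal admissible ideal has a
principal admissible divisor of weight `2` with admissible cofactor. -/
theorem Admissible.exists_isPrincipal_mul {f : ℕ} (hf : InertOrNonprincipal R f)
    (hcl : ∀ I J : Ideal R, I ≠ ⊥ → J ≠ ⊥ → ¬ I.IsPrincipal → ¬ J.IsPrincipal →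
      (I * J).IsPrincipal)
    {I : Ideal R} (hI : I ≠ ⊥) (hI' : I ≠ ⊤) (hadm : Admissible f I) (hpr : I.IsPrincipal) :
    ∃ S T : Ideal R, I = S * T ∧ S ≠ ⊤ ∧ S.IsPrincipal ∧ Admissible f S ∧ Admissible f T ∧
      idealWeight f S = 2 := by
  obtain ⟨S, T, rfl, hS', hS, hT, hw⟩ := hadm.exists_mul hf hI hI'
  by_cases hSp : S.IsPrincipal
  · exact ⟨S, T, rfl, hS', hSp, hS, hT, by rw [hw, if_pos hSp]⟩
  have hS0 : S ≠ ⊥ := fun h ↦ hI (by rw [h, Ideal.bot_mul])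
  have hT0 : T ≠ ⊥ := fun h ↦ hI (by rw [h, Ideal.mul_bot])
  have hT' : T ≠ ⊤ := fun h ↦ hSp (by rwa [h, Ideal.mul_top] at hpr)
  -- If `S` is not principal, a second divisor is split off: either it is principal, of weight 2, or
  -- its product with `S` is principal, of weight `1 + 1`.
  obtain ⟨S₂, U, rfl, hS₂', hS₂, hU, hw₂⟩ := hT.exists_mul hf hT0 hT'
  by_cases hS₂p : S₂.IsPrincipal
  · exact ⟨S₂, S * U, mul_left_comm _ _ _, hS₂', hS₂p, hS₂, hS.mul hU, by rw [hw₂, if_pos hS₂p]⟩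
  have hS₂0 : S₂ ≠ ⊥ := fun h ↦ hT0 (by rw [h, Ideal.bot_mul])
  refine ⟨S * S₂, U, (mul_assoc _ _ _).symm, fun h ↦ hS' ?_, hcl S S₂ hS0 hS₂0 hSp hS₂p,
    hS.mul hS₂, hU, ?_⟩
  · exact top_le_iff.mp (h.ge.trans Ideal.mul_le_left)
  · rw [idealWeight_mul f hS0 hS₂0, hw, hw₂, if_neg hSp, if_neg hS₂p]
    decide

end Weight

end QuadOrder

/-! ### Atoms of the order and an element with lengths 2 and 4. -/

namespace QuadOrder

theorem irreducible_associatesMk_iff {H : Type*} [CommMonoid H] {a : H} :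
    Irreducible (Associates.mk a) ↔ Irreducible a := by
  simp only [irreducible_iff, Associates.isUnit_mk, Associates.forall_associated,
    Associates.mk_mul_mk, Associates.mk_eq_mk_iff_associated, Associated.comm (x := a)]
  refine Iff.rfl.and ⟨?_, ?_⟩
  · rintro h x y rfl
    exact h _ _ (.refl _)
  · rintro h x y ⟨u, rfl⟩
    simpa using h (mul_assoc _ _ _)

theorem card_mem_setOfLengths {H : Type*} [CommMonoid H] {a : H} {s : Multiset H}
    (hs : ∀ u ∈ s, Irreducible u) (ha : Associated s.prod a) :
    Multiset.card s ∈ setOfLengths a := by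
  refine ⟨s.pmap (fun u hu ↦ ⟨Associates.mk u, irreducible_associatesMk_iff.mpr hu⟩) hs, ?_,
    by simp⟩
  rw [factorizations, Set.mem_ofPred_eq, factorizationHom, Multiset.map_pmap,
    Multiset.pmap_eq_map, Associates.prod_mk, Associates.mk_eq_mk_iff_associated]
  exact ha

section Subring

variable {R : Type*} [CommRing R] [IsDomain R] {t m : ℤ} {B : QuadraticBasis R t m}
  {O : Subring R} {f : ℕ}

/-- The inverse of an element of norm `± 1` is its conjugate up to sign, and conjugation preserves
`O`. -/
theorem isUnit_nonZeroDivisors_iff (hO : ∀ x, x ∈ O ↔ (f : ℤ) ∣ B.im x) (a : O⁰) :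
    IsUnit a ↔ IsUnit (B.normForm ((a : O) : R)) := by
  constructor
  · intro h
    exact B.isUnit_normForm (h.map ((O.subtype : O →* R).comp O⁰.subtype))
  · intro h
    have hconj : B.conj ((a : O) : R) ∈ O := by
      rw [hO, QuadraticBasis.im_conj, dvd_neg, ← hO]
      exact (a : O).2
    have hu : IsUnit (a : O) := by
      refine isUnit_of_mul_isUnit_left (y := ⟨_, hconj⟩) ?_
      have : (a : O) * ⟨_, hconj⟩ = ((B.normForm ((a : O) : R) : ℤ) : O) := by
        apply Subtype.ext
        push_cast
        exact B.mul_conj _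
      rw [this]
      exact h.map (Int.castRingHom O)
    obtain ⟨y, hy⟩ := hu.exists_right_inv
    exact IsUnit.of_mul_eq_one (⟨y, mem_nonZeroDivisors_of_ne_zero (right_ne_zero_of_mul_eq_one hy)⟩)
      (Subtype.ext hy)

omit [IsDomain R] in
theorem normForm_natAbs_mul (a b : O⁰) : (B.normForm (((a * b : O⁰) : O) : R)).natAbs =
    (B.normForm ((a : O) : R)).natAbs * (B.normForm ((b : O) : R)).natAbs := by
  rw [← Int.natAbs_mul, ← QuadraticBasis.normForm_mul]
  rfl

theorem isUnit_iff_natAbs_normForm (hO : ∀ x, x ∈ O ↔ (f : ℤ) ∣ B.im x) (a : O⁰) :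
    IsUnit a ↔ (B.normForm ((a : O) : R)).natAbs = 1 := by
  rw [isUnit_nonZeroDivisors_iff hO, Int.isUnit_iff_natAbs_eq]

/-- An element whose norm is the square of a prime number that is not a norm is irreducible. -/
theorem irreducible_of_normForm_sq (hO : ∀ x, x ∈ O ↔ (f : ℤ) ∣ B.im x) {l : ℕ} (hl : l.Prime)
    (hN : ∀ x, (B.normForm x).natAbs ≠ l) {a : O⁰}
    (ha : (B.normForm ((a : O) : R)).natAbs = l ^ 2) : Irreducible a := by
  rw [irreducible_iff, isUnit_iff_natAbs_normForm hO, ha]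
  refine ⟨fun h ↦ hl.ne_one (by simpa using h), fun b c hbc ↦ ?_⟩
  rw [isUnit_iff_natAbs_normForm hO, isUnit_iff_natAbs_normForm hO]
  rw [hbc, normForm_natAbs_mul] at ha
  by_contra! h
  exact hN _ ((hl.mul_eq_prime_sq_iff h.1 h.2).mp ha).1

/-- An element of the order of norm `p ^ 3 * q`, where `p` divides the conductor and the prime
numbers `p` and `q` are not norms, is irreducible. -/
theorem irreducible_of_normForm_cube_mul (hO : ∀ x, x ∈ O ↔ (f : ℤ) ∣ B.im x) {p q : ℕ}
    (hp : p.Prime) (hq : q.Prime) (hpq : p ≠ q) (hpf : p ∣ f)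
    (hN : ∀ x, (B.normForm x).natAbs ≠ q) {a : O⁰}
    (ha : (B.normForm ((a : O) : R)).natAbs = p ^ 3 * q) : Irreducible a := by
  -- As `p ∣ f`, the coordinate at `ω` of `b` is divisible by `p`; if `p` divides the norm, it
  -- divides the other coordinate too. Hence in a factorization only one factor can have norm
  -- divisible by `p`, as `p ^ 4` does not divide `p ^ 3 * q`.
  have hsq : ∀ b : O⁰, p ∣ (B.normForm ((b : O) : R)).natAbs →
      p ^ 2 ∣ (B.normForm ((b : O) : R)).natAbs := fun b hb ↦ by
    have him : (p : ℤ) ∣ B.im ((b : O) : R) :=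
      (Int.natCast_dvd_natCast.mpr hpf).trans ((hO _).mp (b : O).2)
    rw [← Int.natCast_dvd] at hb ⊢
    rw [QuadraticBasis.normForm, Nat.cast_pow] at *
    have hre : (p : ℤ) ∣ B.re ((b : O) : R) := by
      refine (Nat.prime_iff_prime_int.mp hp).dvd_of_dvd_pow (n := 2) ?_
      have := (hb.add ((him.pow two_ne_zero).mul_left m)).sub
        ((him.mul_left (B.re ((b : O) : R))).mul_left t)
      convert this using 1
      ring
    refine ((pow_dvd_pow_of_dvd hre 2).add ?_).sub ((pow_dvd_pow_of_dvd him 2).mul_left m)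
    rw [sq]
    exact (mul_dvd_mul hre him).mul_left t
  have key : ∀ b c : ℕ, b * c = p ^ 3 * q → b ≠ q → ¬ p ∣ b → b = 1 := fun b c h hbq hb ↦ by
    have hcop : Nat.Coprime b (p ^ 3) := ((Nat.Prime.coprime_iff_not_dvd hp).mpr hb).symm.pow_right 3
    exact ((Nat.dvd_prime hq).mp (hcop.dvd_of_dvd_mul_left (Dvd.intro c h))).resolve_right hbq
  rw [irreducible_iff, isUnit_iff_natAbs_normForm hO, ha]
  refine ⟨fun h ↦ hq.ne_one (Nat.eq_one_of_mul_eq_one_left h), fun b c hbc ↦ ?_⟩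
  rw [isUnit_iff_natAbs_normForm hO, isUnit_iff_natAbs_normForm hO]
  rw [hbc, normForm_natAbs_mul] at ha
  by_cases hb : p ∣ (B.normForm ((b : O) : R)).natAbs
  · by_cases hc : p ∣ (B.normForm ((c : O) : R)).natAbs
    · have h := mul_dvd_mul (hsq b hb) (hsq c hc)
      rw [ha, ← pow_add, pow_succ] at h
      exact absurd ((Nat.prime_dvd_prime_iff_eq hp hq).mp
        ((Nat.mul_dvd_mul_iff_left (pow_pos hp.pos 3)).mp h)) hpq
    · exact Or.inr (key _ _ (by rw [mul_comm, ha]) (hN _) hc)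
  · exact Or.inl (key _ _ ha (hN _) hb)

theorem two_mem_setOfLengths_and_four_mem [CharZero R] (hO : ∀ x, x ∈ O ↔ (f : ℤ) ∣ B.im x)
    {p q : ℕ} (hp : p.Prime) (hq : q.Prime) (hpq : p ≠ q) (hpf : p ∣ f)
    (hNp : ∀ x, (B.normForm x).natAbs ≠ p) (hNq : ∀ x, (B.normForm x).natAbs ≠ q) {x : R}
    (hx : (f : ℤ) ∣ B.im x) (hNx : (B.normForm x).natAbs = p ^ 3 * q) :
    ∃ a : O⁰, 2 ∈ setOfLengths a ∧ 4 ∈ setOfLengths a := by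
  have hnz : ∀ y : R, (B.normForm y).natAbs ≠ 0 → y ≠ 0 := by
    rintro _ h rfl
    simp [QuadraticBasis.normForm, QuadraticBasis.re, QuadraticBasis.im] at h
  have lift : ∀ y : R, (f : ℤ) ∣ B.im y → (B.normForm y).natAbs ≠ 0 →
      ∃ b : O⁰, ((b : O) : R) = y := fun y hy hy0 ↦
    ⟨⟨⟨y, (hO y).mpr hy⟩, mem_nonZeroDivisors_of_ne_zero fun h ↦
      hnz y hy0 (congrArg Subtype.val h)⟩, rfl⟩
  have hpq0 : p ^ 3 * q ≠ 0 := mul_ne_zero (pow_ne_zero 3 hp.ne_zero) hq.ne_zero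
  have hNpp : (B.normForm (p : R)).natAbs = p ^ 2 := by
    rw [B.normForm_natCast]
    exact_mod_cast Int.natAbs_natCast _
  have hNqq : (B.normForm (q : R)).natAbs = q ^ 2 := by
    rw [B.normForm_natCast]
    exact_mod_cast Int.natAbs_natCast _
  have hNc : (B.normForm (B.conj x)).natAbs = p ^ 3 * q := by rw [B.normForm_conj, hNx]
  obtain ⟨a, ha⟩ := lift x hx (by rwa [hNx])
  obtain ⟨a', ha'⟩ := lift (B.conj x) (by rwa [B.im_conj, dvd_neg]) (by rwa [hNc])
  obtain ⟨P, hP⟩ := lift p (by simp) (by rw [hNpp]; exact pow_ne_zero 2 hp.ne_zero)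
  obtain ⟨Q, hQ⟩ := lift q (by simp) (by rw [hNqq]; exact pow_ne_zero 2 hq.ne_zero)
  have hai : Irreducible a := irreducible_of_normForm_cube_mul hO hp hq hpq hpf hNq (by rw [ha, hNx])
  have hai' : Irreducible a' :=
    irreducible_of_normForm_cube_mul hO hp hq hpq hpf hNq (by rw [ha', hNc])
  have hPi : Irreducible P := irreducible_of_normForm_sq hO hp hNp (by rw [hP, hNpp])
  have hQi : Irreducible Q := irreducible_of_normForm_sq hO hq hNq (by rw [hQ, hNqq])
  refine ⟨a * a', ?_, ?_⟩
  · exact card_mem_setOfLengths (s := {a, a'}) (by simp [hai, hai']) (by simp)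
  · refine card_mem_setOfLengths (s := {P, P, P, Q}) (by simp [hPi, hQi]) ?_
    have hprod : ((((a * a' : O⁰) : O)) : R) = (B.normForm x : R) := by
      rw [Submonoid.coe_mul, Subring.coe_mul, ha, ha', B.mul_conj]
    have hprod' : (((({P, P, P, Q} : Multiset O⁰).prod : O⁰) : O) : R) = ((p ^ 3 * q : ℕ) : R) := by
      simp only [Multiset.insert_eq_cons, Multiset.prod_cons, Multiset.prod_singleton,
        Submonoid.coe_mul, Subring.coe_mul, hP, hQ]
      push_cast
      ring
    have hneg : (-1 : O) ∈ O⁰ := mem_nonZeroDivisors_of_ne_zero (by simp)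
    have hnegu : IsUnit (⟨-1, hneg⟩ : O⁰) := IsUnit.of_mul_eq_one ⟨-1, hneg⟩ (Subtype.ext (by simp))
    rw [← hNx] at hprod'
    rcases Int.natAbs_eq (B.normForm x) with h | h
    · have : ({P, P, P, Q} : Multiset O⁰).prod = a * a' := by
        apply Subtype.ext
        apply Subtype.ext
        rw [hprod, hprod', h]
        simp
      rw [this]
      exact Associated.refl _
    · refine ⟨hnegu.unit, ?_⟩
      apply Subtype.ext
      apply Subtype.ext
      rw [hprod, h, Submonoid.coe_mul, Subring.coe_mul, hprod']
      simp

end Subring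

/-! ### Atoms have weight 2, and lengths of an element agree modulo 2. -/

section Parity

variable {R : Type*} [CommRing R] [IsDedekindDomain R] [CharZero R] {t m : ℤ}
  {B : QuadraticBasis R t m} {O : Subring R} {f : ℕ} {E E' : R}

-- Modulo a prime `p ∣ f`, the element `x` is the integer `re x`, which is zero or invertible modulo
-- `p`.
omit [IsDedekindDomain R] in
theorem admissible_span_singleton {x : R} (hx : (f : ℤ) ∣ B.im x) :
    Admissible f (Ideal.span {x}) := by
  intro p hp
  have hpp := Nat.prime_of_mem_primeFactors hp
  obtain ⟨s, hs⟩ := (Int.natCast_dvd_natCast.mpr (Nat.dvd_of_mem_primeFactors hp)).trans hx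
  rw [Ideal.span_singleton_le_span_singleton, Ideal.isCoprime_span_singleton_iff]
  by_cases hre : (p : ℤ) ∣ B.re x
  · left
    have := (B.intCast_dvd_iff p x).mpr ⟨hre, s, hs⟩
    simpa using this
  · right
    obtain ⟨u, v, huv⟩ := ((Prime.coprime_iff_not_dvd
      (Nat.prime_iff_prime_int.mp hpp)).mpr hre)
    refine ⟨v, u - v * s * B.gen, ?_⟩
    have huv' : (u * p + v * B.re x : R) = 1 := by exact_mod_cast congrArg (Int.cast (R := R)) huv
    have hx' := B.eq_re_add_im x
    rw [hs] at hx'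
    push_cast at hx'
    linear_combination (v : R) * hx' + huv'

theorem idealWeight_eq_two_of_irreducible (hO : ∀ x, x ∈ O ↔ (f : ℤ) ∣ B.im x)
    (hsf : Squarefree f) (hf : InertOrNonprincipal R f)
    (hcl : ∀ I J : Ideal R, I ≠ ⊥ → J ≠ ⊥ → ¬ I.IsPrincipal → ¬ J.IsPrincipal →
      (I * J).IsPrincipal)
    (hE : E * E' = 1) (n : ℕ → ℕ) (hn : ∀ p ∈ f.primeFactors, B.RepresentsUnits E p (n p))
    (hcop : (f.primeFactors : Set ℕ).Pairwise (Function.onFun Nat.Coprime n)) {a : O⁰}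
    (ha : Irreducible a) : idealWeight f (Ideal.span {((a : O) : R)}) = 2 := by
  have ha0 : ((a : O) : R) ≠ 0 := fun h ↦ nonZeroDivisors.coe_ne_zero a (Subtype.ext h)
  have hunit : ∀ b : O⁰, ∀ y : R, Associated y ((b : O) : R) → IsUnit b → IsUnit y :=
    fun b y hb hu ↦ hb.isUnit_iff.mpr (hu.map ((O.subtype : O →* R).comp O⁰.subtype))
  have haim := (hO _).mp (a : O).2
  obtain ⟨S, T, hST, hS1, ⟨b, hb⟩, hS, hT, hw⟩ :=
    (admissible_span_singleton haim).exists_isPrincipal_mul hf hcl (by simp [ha0])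
      (fun h ↦ ha.not_isUnit ((isUnit_nonZeroDivisors_iff hO a).mpr
        (B.isUnit_normForm (Ideal.span_singleton_eq_top.mp h)))) ⟨_, rfl⟩
  rw [Ideal.submodule_span_eq] at hb
  subst hb
  have hmem : ((a : O) : R) ∈ Ideal.span {b} * T := hST ▸ Ideal.mem_span_singleton_self _
  obtain ⟨c, -, hc⟩ := Ideal.mem_span_singleton_mul.mp hmem
  have hb0 : b ≠ 0 := fun h ↦ ha0 (by rw [← hc, h, zero_mul])
  have hc0 : c ≠ 0 := fun h ↦ ha0 (by rw [← hc, h, mul_zero])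
  obtain rfl : T = Ideal.span {c} := by
    rw [← hc, ← Ideal.span_singleton_mul_span_singleton] at hST
    exact (mul_left_cancel₀ (by simpa using hb0) hST).symm
  have hadm : ∀ y : R, Admissible f (Ideal.span {y}) →
      ∀ p ∈ f.primeFactors, (p : R) ∣ y ∨ IsCoprime y (p : R) := fun y hy p hp ↦ by
    have := hy p hp
    rwa [Ideal.span_singleton_le_span_singleton, Ideal.isCoprime_span_singleton_iff] at this
  obtain ⟨k, hkb, hkc⟩ := QuadraticBasis.exists_pow_mul_of_mul hsf hE n hn hcop
    (b := b) (c := c) (by rwa [hc]) (hadm b hS) (hadm c hT)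
  have hEu : IsUnit (E ^ k) := (IsUnit.of_mul_eq_one _ hE).pow k
  have hE'u : IsUnit (E' ^ k) := (IsUnit.of_mul_eq_one E (by rwa [mul_comm])).pow k
  let b' : O⁰ := ⟨⟨E ^ k * b, (hO _).mpr hkb⟩, mem_nonZeroDivisors_of_ne_zero fun h ↦
    mul_ne_zero hEu.ne_zero hb0 (congrArg Subtype.val h)⟩
  let c' : O⁰ := ⟨⟨E' ^ k * c, (hO _).mpr hkc⟩, mem_nonZeroDivisors_of_ne_zero fun h ↦
    mul_ne_zero hE'u.ne_zero hc0 (congrArg Subtype.val h)⟩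
  have hfac : a = b' * c' := by
    apply Subtype.ext
    apply Subtype.ext
    change ((a : O) : R) = E ^ k * b * (E' ^ k * c)
    rw [← hc]
    have : (E * E') ^ k = 1 := by rw [hE, one_pow]
    rw [mul_pow] at this
    linear_combination -(b * c) * this
  rcases ha.isUnit_or_isUnit hfac with h | h
  -- The factor `b'` generates the proper ideal `S`, so it is `c'` that is a unit, and `a` generates
  -- `S`.
  · refine absurd (Ideal.span_singleton_eq_top.mpr (hunit b' b ?_ h)) hS1
    exact (associated_unit_mul_left b _ hEu).symm
  · have hcu : IsUnit c := hunit c' c (associated_unit_mul_left c _ hE'u).symm h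
    rw [hST, Ideal.span_singleton_eq_top.mpr hcu, Ideal.mul_top, hw]

theorem idealWeight_eq_of_factorizationHom
    (hirr : ∀ a : O⁰, Irreducible a → idealWeight f (Ideal.span {((a : O) : R)}) = 2)
    (z : FactorizationMonoid O⁰) (a : O⁰) (h : factorizationHom O⁰ z = Associates.mk a) :
    idealWeight f (Ideal.span {((a : O) : R)}) = 2 * (Multiset.card z : ZMod 4) := by
  have hassoc : ∀ a b : O⁰, Associates.mk a = Associates.mk b →
      Ideal.span {((a : O) : R)} = Ideal.span {((b : O) : R)} := fun a b hab ↦ by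
    rw [Ideal.span_singleton_eq_span_singleton]
    exact (Associates.mk_eq_mk_iff_associated.mp hab).map ((O.subtype : O →* R).comp O⁰.subtype)
  have hne : ∀ a : O⁰, Ideal.span {((a : O) : R)} ≠ ⊥ := fun a ↦ by
    rw [Ne, Ideal.span_singleton_eq_bot]
    exact fun h ↦ nonZeroDivisors.coe_ne_zero a (Subtype.ext h)
  induction z using Multiset.induction_on generalizing a with
  | empty =>
    have h1 : Associates.mk (1 : O⁰) = Associates.mk a := by
      rw [← h]
      simp [factorizationHom]
    rw [← hassoc _ _ h1]
    simp [idealWeight_top]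
  | cons u z ih =>
    obtain ⟨x, hx⟩ := Associates.mk_surjective u.1
    obtain ⟨y, hy⟩ := Associates.mk_surjective (factorizationHom O⁰ z)
    have hxy : Associates.mk (x * y) = Associates.mk a := by
      rw [← h, ← Associates.mk_mul_mk, hx, hy]
      simp [factorizationHom]
    have hxi : Irreducible x := irreducible_associatesMk_iff.mp (hx ▸ u.2)
    rw [← hassoc _ _ hxy, Submonoid.coe_mul, Subring.coe_mul,
      ← Ideal.span_singleton_mul_span_singleton, idealWeight_mul f (hne x) (hne y), hirr x hxi,
      ih y hy.symm, Multiset.card_cons]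
    push_cast
    ring

theorem modEq_two_of_mem_setOfLengths
    (hirr : ∀ a : O⁰, Irreducible a → idealWeight f (Ideal.span {((a : O) : R)}) = 2) {a : O⁰}
    {k l : ℕ} (hk : k ∈ setOfLengths a) (hl : l ∈ setOfLengths a) : k ≡ l [MOD 2] := by
  obtain ⟨z, hz, rfl⟩ := hk
  obtain ⟨w, hw, rfl⟩ := hl
  have h := (idealWeight_eq_of_factorizationHom hirr z a hz).symm.trans
    (idealWeight_eq_of_factorizationHom hirr w a hw)
  have h' : ((2 * Multiset.card z : ℕ) : ZMod 4) = ((2 * Multiset.card w : ℕ) : ZMod 4) := by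
    exact_mod_cast h
  rw [ZMod.natCast_eq_natCast_iff] at h'
  exact Nat.ModEq.mul_left_cancel' two_ne_zero h'

theorem isLeast_distancesOfDomain_two
    (hirr : ∀ a : O⁰, Irreducible a → idealWeight f (Ideal.span {((a : O) : R)}) = 2)
    (h : ∃ a : O⁰, 2 ∈ setOfLengths a ∧ 4 ∈ setOfLengths a) :
    IsLeast (distancesOfDomain O) 2 := by
  constructor
  · obtain ⟨a, h2, h4⟩ := h
    refine Set.mem_iUnion.mpr ⟨a, two_pos, 2, h2, ?_⟩
    ext k
    constructor
    · rintro ⟨hk, hk2, hk4⟩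
      have := modEq_two_of_mem_setOfLengths hirr hk h2
      simp only [Nat.ModEq] at this
      simp only [Set.mem_insert_iff, Set.mem_singleton_iff]
      omega
    · rintro (rfl | rfl)
      · exact ⟨h2, by simp⟩
      · exact ⟨h4, by simp⟩
  · intro d hd
    obtain ⟨a, hd0, k, hk, heq⟩ := Set.mem_iUnion.mp hd
    have hkd : k + d ∈ setOfLengths a := by
      have : k + d ∈ setOfLengths a ∩ Set.Icc k (k + d) := by
        rw [heq]
        simp
      exact this.1
    have := modEq_two_of_mem_setOfLengths hirr hk hkd
    simp only [Nat.ModEq] at this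
    omega

end Parity

end QuadOrder

namespace QuadOrder

/-! ### Inert and ramified primes, and principal products of primes. -/

section Primes

variable {K : Type*} [Field K] [NumberField K] {t m : ℤ}

theorem absNorm_span_singleton_eq (B : QuadraticBasis (𝓞 K) t m)
    (x : 𝓞 K) :
    Ideal.absNorm (Ideal.span {x}) = (B.normForm x).natAbs := by
  rw [Ideal.absNorm_span_singleton, B.norm_eq_normForm]

theorem absNorm_span_natCast (B : QuadraticBasis (𝓞 K) t m)
    (p : ℕ) : Ideal.absNorm (Ideal.span {(p : 𝓞 K)}) = p ^ 2 := by
  rw [absNorm_span_singleton_eq B, B.normForm_natCast]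
  exact_mod_cast Int.natAbs_natCast _

theorem absNorm_of_span_eq_sq (B : QuadraticBasis (𝓞 K) t m)
    {p : ℕ} {P : Ideal (𝓞 K)}
    (h : Ideal.span {(p : 𝓞 K)} = P ^ 2) : Ideal.absNorm P = p := by
  have := congrArg Ideal.absNorm h
  rw [absNorm_span_natCast B, map_pow] at this
  exact (Nat.pow_left_injective two_ne_zero this).symm

/-- If the norm form is anisotropic modulo `p`, then `p ∣ N(x)` implies `p ∣ x`, and primality of
`p` in `𝓞 K` follows from multiplicativity of the norm. -/
theorem isInertPrime_of_forall_zmod (B : QuadraticBasis (𝓞 K) t m)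
    {p : ℕ} (hp : p.Prime)
    (h : ∀ a b : ZMod p, a ^ 2 + t * (a * b) - m * b ^ 2 = 0 → a = 0 ∧ b = 0) :
    IsInertPrime K p := by
  have hp0 : (p : 𝓞 K) ≠ 0 := by exact_mod_cast hp.ne_zero
  have hpz := Nat.prime_iff_prime_int.mp hp
  have key : ∀ x : 𝓞 K, (p : ℤ) ∣ B.normForm x → (p : 𝓞 K) ∣ x := fun x hx ↦ by
    rw [← ZMod.intCast_zmod_eq_zero_iff_dvd _ p, QuadraticBasis.normForm] at hx
    push_cast at hx
    have := h _ _ hx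
    rw [ZMod.intCast_zmod_eq_zero_iff_dvd, ZMod.intCast_zmod_eq_zero_iff_dvd,
      ← B.intCast_dvd_iff] at this
    simpa using this
  refine ⟨hp, (Ideal.span_singleton_prime hp0).mpr ⟨hp0, fun hu ↦ ?_, fun x y hxy ↦ ?_⟩⟩
  · have := B.isUnit_normForm hu
    rw [B.normForm_natCast] at this
    exact hpz.not_isUnit (isUnit_of_dvd_unit (dvd_pow_self _ two_ne_zero) this)
  · have hd : (p : ℤ) ∣ B.normForm (x * y) := by
      obtain ⟨z, hz⟩ := hxy
      rw [hz, B.normForm_mul, B.normForm_natCast]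
      exact (dvd_pow_self _ two_ne_zero).mul_right _
    rw [B.normForm_mul] at hd
    exact (hpz.dvd_or_dvd hd).imp (key x) (key y)

/-- The first two equations say that `r` is a double root of `X ^ 2 - t X - m` modulo `p`; the prime
is `P = (p, ω - r)`. Since `(ω - r) ^ 2 = p (s (ω - r) + n + s r)`, coprimality of `p` and `n + s r`
yields `p ∈ P ^ 2`. -/
theorem isRamifiedPrime_of_eq (B : QuadraticBasis (𝓞 K) t m)
    {p : ℕ} (hp : p.Prime) {r s n : ℤ} (hs : t - 2 * r = p * s)
    (hn : m + r ^ 2 = p * n) (hcop : IsCoprime (p : ℤ) (n + s * r)) : IsRamifiedPrime K p := by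
  have hsq : Ideal.span {(p : 𝓞 K)} = Ideal.span {(p : 𝓞 K), B.gen - r} ^ 2 := by
    have hs' : (t - 2 * r : 𝓞 K) = p * s := by exact_mod_cast congrArg (Int.cast (R := 𝓞 K)) hs
    have hn' : (m + r ^ 2 : 𝓞 K) = p * n := by exact_mod_cast congrArg (Int.cast (R := 𝓞 K)) hn
    have hω : (B.gen - r) * (B.gen - r) = p * (s * B.gen + n) := by
      linear_combination B.gen_mul_self + B.gen * hs' + hn'
    rw [sq, Ideal.span_pair_mul_span_pair]
    apply le_antisymm
    · rw [Ideal.span_singleton_le_iff_mem]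
      obtain ⟨u, v, huv⟩ := hcop
      have huv' : (u * p + v * (n + s * r) : 𝓞 K) = 1 := by
        exact_mod_cast congrArg (Int.cast (R := 𝓞 K)) huv
      have : (p : 𝓞 K) = u * (p * p) + v * ((B.gen - r) * (B.gen - r)) -
          v * s * (p * (B.gen - r)) := by
        linear_combination -p * huv' - v * hω
      have key : ∀ I : Ideal (𝓞 K), (p * p : 𝓞 K) ∈ I → p * (B.gen - r) ∈ I →
          (B.gen - r) * (B.gen - r) ∈ I → (p : 𝓞 K) ∈ I := fun I h₁ h₂ h₃ ↦ by
        rw [this]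
        exact sub_mem (add_mem (I.mul_mem_left _ h₁) (I.mul_mem_left _ h₃)) (I.mul_mem_left _ h₂)
      exact key _ (Ideal.subset_span (by simp)) (Ideal.subset_span (by simp))
        (Ideal.subset_span (by simp))
    · rw [Ideal.span_le]
      rintro x (rfl | rfl | rfl | rfl) <;> rw [SetLike.mem_coe, Ideal.mem_span_singleton]
      · exact dvd_mul_right _ _
      · exact dvd_mul_right _ _
      · exact dvd_mul_left _ _
      · exact ⟨_, hω⟩
  refine ⟨hp, _, Ideal.isPrime_of_irreducible_absNorm ?_, hsq⟩
  rw [absNorm_of_span_eq_sq B hsq]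
  exact hp

theorem not_isPrincipal_of_span_eq_sq (B : QuadraticBasis (𝓞 K) t m)
    {p : ℕ} {P : Ideal (𝓞 K)}
    (h : Ideal.span {(p : 𝓞 K)} = P ^ 2) (hN : ∀ x, (B.normForm x).natAbs ≠ p) :
    ¬ P.IsPrincipal := by
  rintro ⟨x, rfl⟩
  refine hN x ?_
  rw [← absNorm_span_singleton_eq]
  exact absNorm_of_span_eq_sq B h

theorem inertOrNonprincipal_of_forall (B : QuadraticBasis (𝓞 K) t m)
    {f : ℕ}
    (h : ∀ p ∈ f.primeFactors, IsInertPrime K p ∨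
      IsRamifiedPrime K p ∧ ∀ x, (B.normForm x).natAbs ≠ p) : InertOrNonprincipal (𝓞 K) f :=
  fun p hp ↦ (h p hp).imp And.right fun ⟨⟨_, P, hP, hPp⟩, hN⟩ ↦
    ⟨P, hP, hPp, not_isPrincipal_of_span_eq_sq B hPp hN⟩

theorem eq_of_natCast_mem {q : ℕ} (hq : q ≠ 0) {P Q : Ideal (𝓞 K)} (hP : P.IsPrime)
    (hQ : Q.IsPrime) (hQq : Ideal.span {(q : 𝓞 K)} = Q ^ 2) (hqP : (q : 𝓞 K) ∈ P) : Q = P := by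
  have hQ0 : Q ≠ ⊥ := by
    rintro rfl
    have hq' : (q : 𝓞 K) ≠ 0 := by exact_mod_cast hq
    rw [← Ideal.zero_eq_bot, zero_pow two_ne_zero, Ideal.zero_eq_bot,
      Ideal.span_singleton_eq_bot] at hQq
    exact hq' hQq
  refine (hQ.isMaximal hQ0).eq_of_le hP.ne_top ?_
  rw [← Ideal.span_singleton_le_iff_mem, hQq] at hqP
  exact Ideal.IsPrime.le_of_pow_le hqP

/-- If `pq` is up to sign a norm, where `q` is ramified, then the product of the prime above `q`
with a prime above `p` is principal. -/
theorem isPrincipal_mul_of_normForm (B : QuadraticBasis (𝓞 K) t m)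
    {p q : ℕ} (hp : p.Prime) (hq : q.Prime) (hpq : p ≠ q)
    {P Q : Ideal (𝓞 K)} (hP : P.IsPrime) (hpP : (p : 𝓞 K) ∈ P) (hQ : Q.IsPrime)
    (hQq : Ideal.span {(q : 𝓞 K)} = Q ^ 2) {y : 𝓞 K} (hy : (B.normForm y).natAbs = p * q) :
    (P * Q).IsPrincipal := by
  -- Either `y` or its conjugate lies in `P`. The cofactor of `P` in the ideal it generates has norm
  -- `q`, hence is the only prime `Q` above `q`.
  obtain ⟨x, hx, hxP⟩ : ∃ x, (B.normForm x).natAbs = p * q ∧ x ∈ P := by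
    have : y * B.conj y ∈ P := by
      obtain ⟨z, hz⟩ : (p : ℤ) ∣ B.normForm y := Int.natCast_dvd.mpr (hy ▸ dvd_mul_right p q)
      rw [B.mul_conj, hz]
      push_cast
      exact P.mul_mem_right _ hpP
    rcases hP.mem_or_mem this with h | h
    · exact ⟨y, hy, h⟩
    · exact ⟨_, by rw [B.normForm_conj, hy], h⟩
  obtain ⟨J, hJ⟩ := Ideal.dvd_iff_le.mpr ((Ideal.span_singleton_le_iff_mem P).mpr hxP)
  have hmul : Ideal.absNorm P * Ideal.absNorm J = p * q := by
    rw [← map_mul, ← hJ, absNorm_span_singleton_eq B, hx]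
  have hPdvd : Ideal.absNorm P ∣ p ^ 2 := by
    rw [← absNorm_span_natCast B]
    exact Ideal.absNorm_dvd_absNorm_of_le ((Ideal.span_singleton_le_iff_mem P).mpr hpP)
  have hP1 : Ideal.absNorm P ≠ 1 := fun h ↦ hP.ne_top (Ideal.absNorm_eq_one_iff.mp h)
  have hPp : Ideal.absNorm P = p := by
    obtain ⟨i, hi, hPi⟩ := (Nat.dvd_prime_pow hp).mp hPdvd
    interval_cases i
    · exact absurd hPi (by simpa using hP1)
    · simpa using hPi
    · rw [hPi, sq, mul_assoc] at hmul
      have := Nat.eq_of_mul_eq_mul_left hp.pos hmul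
      exact absurd ((Nat.prime_dvd_prime_iff_eq hp hq).mp (Dvd.intro _ this)) hpq
  rw [hPp] at hmul
  have hJq : Ideal.absNorm J = q := Nat.eq_of_mul_eq_mul_left hp.pos hmul
  have hJp : J.IsPrime := Ideal.isPrime_of_irreducible_absNorm (by rw [hJq]; exact hq)
  have hQJ : Q = J := eq_of_natCast_mem hq.ne_zero hJp hQ hQq (by
    have := Ideal.absNorm_mem J
    rwa [hJq] at this)
  exact ⟨x, by rw [hQJ, ← hJ]⟩

end Primes

/-! ### The class group via the Minkowski bound. -/

section ClassGroup

theorem exists_prime_natCast_mem {R : Type*} [CommRing R] {P : Ideal R} (hP : P.IsPrime) (n : ℕ)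
    (hn : n ≠ 0) (h : (n : R) ∈ P) : ∃ p : ℕ, p.Prime ∧ p ∣ n ∧ (p : R) ∈ P := by
  induction n using Nat.strong_induction_on with
  | _ n ih =>
    have h1 : n ≠ 1 := by
      rintro rfl
      exact hP.ne_top ((Ideal.eq_top_iff_one P).mpr (by simpa using h))
    obtain ⟨k, hk⟩ := Nat.minFac_dvd n
    have hpr := Nat.minFac_prime h1
    rw [hk, Nat.cast_mul] at h
    rcases hP.mem_or_mem h with h | h
    · exact ⟨_, hpr, Nat.minFac_dvd n, h⟩
    · have hk0 : k ≠ 0 := by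
        rintro rfl
        exact hn (by simpa using hk)
      have hlt : k < n := by
        have h2 := hpr.two_le
        calc k < 2 * k := by omega
          _ ≤ n.minFac * k := Nat.mul_le_mul_right k h2
          _ = n := hk.symm
      obtain ⟨p, hp, hpk, hpP⟩ := ih k hlt hk0 h
      exact ⟨p, hp, hpk.trans (Dvd.intro_left _ hk.symm), hpP⟩

variable {R : Type*} [CommRing R] [IsDedekindDomain R]

theorem isPrincipal_mul_of_isPrincipal_mul {Q : Ideal R} {x : R} (hx : x ≠ 0)
    (hQ : Q ^ 2 = Ideal.span {x}) {I J : Ideal R}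
    (hI : (I * Q).IsPrincipal) (hJ : (J * Q).IsPrincipal) : (I * J).IsPrincipal := by
  refine isPrincipal_of_span_singleton_mul hx ?_
  have := (Ideal.isPrincipalSubmonoid R).mul_mem hI hJ
  have heq : I * Q * (J * Q) = Ideal.span {x} * (I * J) := by
    rw [← hQ]
    ring
  rwa [heq] at this

variable {K : Type*} [Field K] [NumberField K]

/-- For a real quadratic field the Minkowski bound is `√d / 2`, and the hypothesis on `N` says that
it is less than `N + 1`. -/
theorem exists_ideal_of_discr_lt (hK : Module.finrank ℚ K = 2) (hd : 0 < NumberField.discr K)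
    {N : ℕ} (hN : NumberField.discr K < (2 * (N + 1)) ^ 2) (C : ClassGroup (𝓞 K)) :
    ∃ I : (Ideal (𝓞 K))⁰, ClassGroup.mk0 I = C ∧ Ideal.absNorm (I : Ideal (𝓞 K)) ≤ N := by
  have hr : NumberField.InfinitePlace.nrComplexPlaces K = 0 := by
    have h1 := NumberField.InfinitePlace.card_add_two_mul_card_eq_rank K
    have h2 := NumberField.sign_discr K
    rw [hK] at h1
    rw [Int.sign_eq_one_of_pos hd] at h2
    have h3 : NumberField.InfinitePlace.nrComplexPlaces K ≤ 1 := by omega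
    interval_cases NumberField.InfinitePlace.nrComplexPlaces K
    · rfl
    · norm_num at h2
  obtain ⟨I, hI, hle⟩ := NumberField.exists_ideal_in_class_of_norm_le C
  refine ⟨I, hI, Nat.lt_succ_iff.mp ?_⟩
  rw [hr, hK, pow_zero, one_mul, abs_of_pos (by exact_mod_cast hd)] at hle
  have hlt : √(NumberField.discr K : ℝ) < 2 * (N + 1) := by
    rw [Real.sqrt_lt' (by positivity)]
    exact_mod_cast hN
  have hfac : ((Nat.factorial 2 : ℕ) : ℝ) / ((2 : ℕ) : ℝ) ^ 2 = 1 / 2 := by norm_num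
  rw [hfac] at hle
  have : (Ideal.absNorm (I : Ideal (𝓞 K)) : ℝ) < (N + 1 : ℕ) := by
    push_cast
    linarith
  exact_mod_cast this

/-- The product of two nonprincipal ideals is principal, if this is so for the primes below the
Minkowski bound and a fixed ideal `Q` whose square is principal. -/
theorem isPrincipal_mul_of_discr_lt (hK : Module.finrank ℚ K = 2) (hd : 0 < NumberField.discr K)
    {N : ℕ} (hN : NumberField.discr K < (2 * (N + 1)) ^ 2) {Q : Ideal (𝓞 K)} {x : 𝓞 K}
    (hx : x ≠ 0) (hQ : Q ^ 2 = Ideal.span {x})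
    (h : ∀ p ≤ N, p.Prime → ∀ P : Ideal (𝓞 K), P.IsPrime → (p : 𝓞 K) ∈ P →
      P.IsPrincipal ∨ (P * Q).IsPrincipal) (I J : Ideal (𝓞 K)) (hI0 : I ≠ ⊥) (hJ0 : J ≠ ⊥)
    (hI : ¬ I.IsPrincipal) (hJ : ¬ J.IsPrincipal) : (I * J).IsPrincipal := by
  have hmul : ∀ {I J : Ideal (𝓞 K)}, I.IsPrincipal → J.IsPrincipal → (I * J).IsPrincipal :=
    fun hI hJ ↦ (Ideal.isPrincipalSubmonoid (𝓞 K)).mul_mem hI hJ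
  -- Closed under products because `Q ^ 2` is principal. It contains the prime divisors of an ideal
  -- of norm at most `N`, hence such an ideal, and every ideal class has one.
  let T : Submonoid (Ideal (𝓞 K)) :=
    { carrier := {I | I.IsPrincipal ∨ (I * Q).IsPrincipal}
      one_mem' := Or.inl (Ideal.isPrincipalSubmonoid (𝓞 K)).one_mem
      mul_mem' := by
        rintro I J (hI | hI) (hJ | hJ)
        · exact Or.inl (hmul hI hJ)
        · exact Or.inr (by rw [mul_assoc]; exact hmul hI hJ)
        · exact Or.inr (by rw [mul_right_comm]; exact hmul hI hJ)
        · exact Or.inl (isPrincipal_mul_of_isPrincipal_mul hx hQ hI hJ) }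
  have hT : ∀ I : Ideal (𝓞 K), I ∈ T ↔ I.IsPrincipal ∨ (I * Q).IsPrincipal := fun _ ↦ Iff.rfl
  have hall : ∀ I : Ideal (𝓞 K), I ≠ ⊥ → I ∈ T := by
    intro I hI0
    obtain ⟨J, hJI, hJN⟩ := exists_ideal_of_discr_lt hK hd hN
      (ClassGroup.mk0 ⟨I, mem_nonZeroDivisors_of_ne_zero hI0⟩)
    obtain ⟨a, b, ha, hb, hab⟩ := ClassGroup.mk0_eq_mk0_iff.mp hJI
    have hJT : (J : Ideal (𝓞 K)) ∈ T := by
      have hJ0 : (J : Ideal (𝓞 K)) ≠ 0 := nonZeroDivisors.coe_ne_zero J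
      rw [← Ideal.prod_normalizedFactors_eq_self hJ0]
      refine Submonoid.multiset_prod_mem _ _ fun P hP ↦ ?_
      obtain ⟨hPp, hPJ⟩ := (Ideal.mem_normalizedFactors_iff hJ0).mp hP
      have hJne := Ideal.absNorm_ne_zero_of_nonZeroDivisors J
      have hdvd := Ideal.absNorm_dvd_absNorm_of_le hPJ
      obtain ⟨p, hp, hpn, hpP⟩ := exists_prime_natCast_mem hPp (Ideal.absNorm P)
        (fun h0 ↦ hJne (by rwa [h0, zero_dvd_iff] at hdvd)) (Ideal.absNorm_mem P)
      exact h p ((Nat.le_of_dvd (Nat.pos_of_ne_zero hJne) (hpn.trans hdvd)).trans hJN) hp P hPp hpP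
    have haT : Ideal.span {a} * (J : Ideal (𝓞 K)) ∈ T := T.mul_mem (Or.inl ⟨a, rfl⟩) hJT
    rw [hab, hT] at haT
    refine haT.imp (isPrincipal_of_span_singleton_mul hb) fun h ↦ ?_
    rw [mul_assoc] at h
    exact isPrincipal_of_span_singleton_mul hb h
  exact isPrincipal_mul_of_isPrincipal_mul hx hQ (((hT I).mp (hall I hI0)).resolve_left hI)
    (((hT J).mp (hall J hJ0)).resolve_left hJ)

end ClassGroup

end QuadOrder

namespace QuadOrder

/-! ### Criteria that reduce the theorem to finite computations. -/

section Criteria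

variable {R : Type*} [CommRing R] {t m : ℤ}

/-- Quadratic residue symbols modulo `5` exclude certain norms. -/
theorem normForm_natAbs_ne (B : QuadraticBasis R t m) {e : ℤ} (h : t ^ 2 + 4 * m = 5 * e)
    (he : e % 5 = 2 ∨ e % 5 = 3) {l : ℕ} (hl : l = 5 ∨ l % 5 = 2 ∨ l % 5 = 3) (x : R) :
    (B.normForm x).natAbs ≠ l := by
  intro hx
  -- Modulo 5 this makes `± N` a square, which excludes `l ≡ ± 2`. If `N = ± 5`, dividing by 5 gives
  -- `e b ^ 2 ≡ ± 1`, impossible because `e` is a nonresidue while `± 1` are squares.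
  have hsq : (2 * B.re x + t * B.im x) ^ 2 = 4 * B.normForm x + 5 * (e * B.im x ^ 2) := by
    rw [QuadraticBasis.normForm]
    linear_combination B.im x ^ 2 * h
  generalize 2 * B.re x + t * B.im x = X at hsq
  generalize B.im x = b at hsq
  generalize B.normForm x = N at hsq hx
  have hmod : ∀ z : ℤ, z ^ 2 % 5 = 0 ∧ z % 5 = 0 ∨ z ^ 2 % 5 = 1 ∨ z ^ 2 % 5 = 4 := fun z ↦ by
    have h : z % 5 = 0 ∨ z % 5 = 1 ∨ z % 5 = 2 ∨ z % 5 = 3 ∨ z % 5 = 4 := by omega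
    rcases h with h | h | h | h | h <;> simp [sq, Int.mul_emod, h]
  rcases hl with rfl | hl
  · have hX : X % 5 = 0 := by
      rcases hmod X with h | h
      · exact h.2
      · omega
    obtain ⟨z, rfl⟩ := Int.dvd_of_emod_eq_zero hX
    have h5 : 5 * (5 * z ^ 2) = 4 * N + 5 * (e * b ^ 2) := by rw [← hsq]; ring
    have hb := hmod b
    have heb : e * b ^ 2 % 5 = (e % 5) * (b ^ 2 % 5) % 5 := Int.mul_emod _ _ _
    rcases he with he | he <;> rcases hb with hb | hb | hb <;>
      simp only [he, hb] at heb <;> omega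
  · have := hmod X
    omega

/-- Multiplication by `e₀ + e₁ ω` in coordinates. -/
def mulCoord {S : Type*} [CommRing S] (t m e₀ e₁ : S) (x : S × S) : S × S :=
  (x.1 * e₀ + m * (x.2 * e₁), x.1 * e₁ + x.2 * e₀ + t * (x.2 * e₁))

theorem mulCoord_iterate (B : QuadraticBasis R t m) (p : ℕ) (E x : R) (k : ℕ) :
    ((B.re (E ^ k * x) : ZMod p), (B.im (E ^ k * x) : ZMod p)) =
      (mulCoord (t : ZMod p) m (B.re E) (B.im E))^[k] (B.re x, B.im x) := by
  induction k with
  | zero => simp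
  | succ k ih =>
    rw [Function.iterate_succ_apply', ← ih, mulCoord, pow_succ, mul_right_comm]
    generalize E ^ k * x = y
    rw [B.re_mul, B.im_mul]
    push_cast
    rfl

/-- Multiplication by `E` is carried out on coordinates in `ZMod p`, so that for concrete `p` the
condition is decidable. -/
theorem representsUnits_of_forall_zmod (B : QuadraticBasis R t m) {p n : ℕ} (e₀ e₁ : ℤ)
    (h : ((mulCoord (t : ZMod p) m e₀ e₁)^[n] (1, 0)).2 = 0 ∧
      ∀ a b : ZMod p, a ^ 2 + t * (a * b) - m * b ^ 2 ≠ 0 →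
        ∃ k < n, ((mulCoord (t : ZMod p) m e₀ e₁)^[k] (a, b)).2 = 0) :
    B.RepresentsUnits (e₀ + e₁ * B.gen) p n := by
  have key : ∀ (k : ℕ) (x : R), (p : ℤ) ∣ B.im ((e₀ + e₁ * B.gen) ^ k * x) ↔
      ((mulCoord (t : ZMod p) m e₀ e₁)^[k] (B.re x, B.im x)).2 = 0 := fun k x ↦ by
    have := mulCoord_iterate B p (e₀ + e₁ * B.gen) x k
    rw [B.re_add_mul_gen, B.im_add_mul_gen] at this
    rw [← this, ZMod.intCast_zmod_eq_zero_iff_dvd]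
  constructor
  · have := (key n 1).mpr (by simpa using h.1)
    rwa [mul_one] at this
  · intro x hx
    obtain ⟨k, hk, hk'⟩ := h.2 (B.re x) (B.im x) (fun h0 ↦ hx (by
      rw [← ZMod.intCast_zmod_eq_zero_iff_dvd, QuadraticBasis.normForm]
      exact_mod_cast h0))
    exact ⟨k, hk, (key k x).mpr hk'⟩

end Criteria

variable {K : Type*} [Field K] [NumberField K] {t m : ℤ}

/-- The prime `Q` above 5 serves as the fixed ideal. Up to the Minkowski bound, a prime `P` is
principal if it lies above an inert number, and `P * Q` is principal if it lies above 5 or above a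
`p` for which `± 5 p` is a norm. -/
theorem isPrincipal_mul_of_isRamifiedPrime_five (B : QuadraticBasis (𝓞 K) t m)
    (hK : Module.finrank ℚ K = 2) (hd : 0 < t ^ 2 + 4 * m) {N : ℕ}
    (hN : t ^ 2 + 4 * m < (2 * (N + 1)) ^ 2) (h5 : IsRamifiedPrime K 5)
    (h : ∀ p ≤ N, p.Prime → p = 5 ∨ IsInertPrime K p ∨
      ∃ a b : ℤ, (a ^ 2 + t * (a * b) - m * b ^ 2).natAbs = p * 5)
    (I J : Ideal (𝓞 K)) (hI0 : I ≠ ⊥) (hJ0 : J ≠ ⊥) (hI : ¬ I.IsPrincipal)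
    (hJ : ¬ J.IsPrincipal) : (I * J).IsPrincipal := by
  obtain ⟨hp5, Q, hQ, hQ5⟩ := h5
  rw [← B.discr_numberField] at hd hN
  have h50 : ((5 : ℕ) : 𝓞 K) ≠ 0 := by exact_mod_cast hp5.ne_zero
  refine isPrincipal_mul_of_discr_lt hK hd hN h50 hQ5.symm (fun p hpN hp P hP hpP ↦ ?_) I J hI0 hJ0
    hI hJ
  rcases h p hpN hp with rfl | ⟨-, hin⟩ | ⟨a, b, hab⟩
  · right
    rw [← eq_of_natCast_mem hp5.ne_zero hP hQ hQ5 hpP, ← sq, ← hQ5]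
    exact ⟨_, rfl⟩
  · left
    have hp0 : (p : 𝓞 K) ≠ 0 := by exact_mod_cast hp.ne_zero
    rw [← (hin.isMaximal (by simpa using hp0)).eq_of_le hP.ne_top
      ((Ideal.span_singleton_le_iff_mem P).mpr hpP)]
    exact ⟨_, rfl⟩
  · rcases eq_or_ne p 5 with rfl | hne
    · right
      rw [← eq_of_natCast_mem hp5.ne_zero hP hQ hQ5 hpP, ← sq, ← hQ5]
      exact ⟨_, rfl⟩
    · right
      exact isPrincipal_mul_of_normForm B hp hp5 hne hP hpP hQ hQ5 (y := a + b * B.gen)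
        (by rw [B.normForm_add_mul_gen, hab])

/-- A criterion for the minimal distance of an order to be two. -/
theorem isLeast_distancesOfDomain_two_of_representsUnits (B : QuadraticBasis (𝓞 K) t m) {e : ℤ}
    (h : t ^ 2 + 4 * m = 5 * e) (he : e % 5 = 2 ∨ e % 5 = 3) {f : ℕ} {O : Subring (𝓞 K)}
    (hf : orderConductor O = Ideal.span {(f : 𝓞 K)}) (hsf : Squarefree f)
    (hcl : ∀ I J : Ideal (𝓞 K), I ≠ ⊥ → J ≠ ⊥ → ¬ I.IsPrincipal → ¬ J.IsPrincipal →
      (I * J).IsPrincipal)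
    (hprime : ∀ p ∈ f.primeFactors, IsInertPrime K p ∨
      IsRamifiedPrime K p ∧ (p = 5 ∨ p % 5 = 2 ∨ p % 5 = 3))
    (e₀ e₁ : ℤ) (hE : IsUnit (e₀ ^ 2 + t * (e₀ * e₁) - m * e₁ ^ 2)) (n : ℕ → ℕ)
    (hn : ∀ p ∈ f.primeFactors, B.RepresentsUnits (e₀ + e₁ * B.gen) p (n p))
    (hcop : (f.primeFactors : Set ℕ).Pairwise (Function.onFun Nat.Coprime n))
    {p q : ℕ} (hp : p.Prime) (hq : q.Prime) (hpq : p ≠ q) (hpf : p ∣ f)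
    (hp5 : p = 5 ∨ p % 5 = 2 ∨ p % 5 = 3) (hq5 : q = 5 ∨ q % 5 = 2 ∨ q % 5 = 3) (a b : ℤ)
    (hb : (f : ℤ) ∣ b) (hab : (a ^ 2 + t * (a * b) - m * b ^ 2).natAbs = p ^ 3 * q) :
    IsLeast (distancesOfDomain O) 2 := by
  have hO := B.mem_subring_iff hf
  have hN : ∀ l : ℕ, l = 5 ∨ l % 5 = 2 ∨ l % 5 = 3 → ∀ x, (B.normForm x).natAbs ≠ l :=
    fun l hl ↦ normForm_natAbs_ne B h he hl
  -- The excluded norms `hN` serve twice: ramified primes above `f` are nonprincipal, and `p`, `q`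
  -- and the elements of norm `± p ^ 3 * q` in `O` are atoms.
  rw [← B.normForm_add_mul_gen] at hE hab
  obtain ⟨E', hE'⟩ := (B.isUnit_of_normForm hE).exists_right_inv
  refine isLeast_distancesOfDomain_two (f := f) (fun x hx ↦
    idealWeight_eq_two_of_irreducible hO hsf (inertOrNonprincipal_of_forall B fun l hl ↦
      (hprime l hl).imp_right (And.imp_right (hN l))) hcl hE' n hn hcop hx) ?_
  exact two_mem_setOfLengths_and_four_mem hO hp hq hpq hpf (hN p hp5) (hN q hq5)
    (x := a + b * B.gen) (by rwa [B.im_add_mul_gen]) hab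

theorem mem_triple_of_prime_dvd_mul {a b c p : ℕ} (ha : a.Prime) (hb : b.Prime) (hc : c.Prime)
    (hp : p.Prime) (h : p ∣ a * b * c) : p = a ∨ p = b ∨ p = c := by
  rw [hp.dvd_mul, hp.dvd_mul, Nat.prime_dvd_prime_iff_eq hp ha, Nat.prime_dvd_prime_iff_eq hp hb,
    Nat.prime_dvd_prime_iff_eq hp hc] at h
  tauto

theorem mem_pair_of_prime_dvd_mul {a b p : ℕ} (ha : a.Prime) (hb : b.Prime) (hp : p.Prime)
    (h : p ∣ a * b) : p = a ∨ p = b := by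
  rwa [hp.dvd_mul, Nat.prime_dvd_prime_iff_eq hp ha, Nat.prime_dvd_prime_iff_eq hp hb] at h

theorem squarefree_mul_of_ne {a b : ℕ} (ha : a.Prime) (hb : b.Prime) (hab : a ≠ b) :
    Squarefree (a * b) := by
  rw [Nat.squarefree_mul ((Nat.coprime_primes ha hb).mpr hab)]
  exact ⟨ha.squarefree, hb.squarefree⟩

theorem squarefree_mul_mul {a b c : ℕ} (ha : a.Prime) (hb : b.Prime) (hc : c.Prime) (hab : a ≠ b)
    (hac : a ≠ c) (hbc : b ≠ c) : Squarefree (a * b * c) := by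
  have h₁ : Nat.Coprime a b := (Nat.coprime_primes ha hb).mpr hab
  have h₂ : Nat.Coprime (a * b) c :=
    Nat.Coprime.mul_left ((Nat.coprime_primes ha hc).mpr hac) ((Nat.coprime_primes hb hc).mpr hbc)
  rw [Nat.squarefree_mul h₂, Nat.squarefree_mul h₁]
  exact ⟨⟨ha.squarefree, hb.squarefree⟩, hc.squarefree⟩

/-! ### The five discriminants. -/

theorem isRamifiedPrime_of_discr_sixty (B : QuadraticBasis (𝓞 K) 0 15) :
    IsRamifiedPrime K 2 ∧ IsRamifiedPrime K 3 ∧ IsRamifiedPrime K 5 := by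
  refine ⟨isRamifiedPrime_of_eq B Nat.prime_two (r := 1) (s := -1) (n := 8) ?_ ?_ ?_,
    isRamifiedPrime_of_eq B Nat.prime_three (r := 0) (s := 0) (n := 5) ?_ ?_ ?_,
    isRamifiedPrime_of_eq B Nat.prime_five (r := 0) (s := 0) (n := 3) ?_ ?_ ?_⟩ <;> norm_num

theorem isLeast_of_discr_sixty (hK : Module.finrank ℚ K = 2) (B : QuadraticBasis (𝓞 K) 0 15)
    {f : ℕ} {O : Subring (𝓞 K)} (hf : orderConductor O = Ideal.span {(f : 𝓞 K)})
    (hf30 : f ∣ 30) {p : ℕ} (hp : p.Prime) (hpf : p ∣ f)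
    (hp5 : p = 5 ∨ p % 5 = 2 ∨ p % 5 = 3) (a b : ℤ)
    (hb : (f : ℤ) ∣ b) (hab : (a ^ 2 - 15 * b ^ 2).natAbs = p ^ 3 * 7) :
    IsLeast (distancesOfDomain O) 2 := by
  obtain ⟨h2, h3, h5⟩ := isRamifiedPrime_of_discr_sixty B
  have hpf' : ∀ l ∈ f.primeFactors, l = 2 ∨ l = 3 ∨ l = 5 := fun l hl ↦
    mem_triple_of_prime_dvd_mul Nat.prime_two Nat.prime_three Nat.prime_five
      (Nat.prime_of_mem_primeFactors hl) ((Nat.dvd_of_mem_primeFactors hl).trans hf30)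
  have h30 : Squarefree 30 :=
    squarefree_mul_mul Nat.prime_two Nat.prime_three Nat.prime_five
      (by norm_num) (by norm_num) (by norm_num)
  -- The unit is `4 + √15`. Units modulo a ramified `p`, up to integers, form a group of order `p`,
  -- whence `n = id`.
  refine isLeast_distancesOfDomain_two_of_representsUnits B (e := 12) (by norm_num) (by norm_num)
    hf (h30.squarefree_of_dvd hf30)
    (isPrincipal_mul_of_isRamifiedPrime_five B hK (N := 3) (by norm_num) (by norm_num) h5 ?_)
    ?_ 4 1 (by norm_num) id ?_ ?_ hp (q := 7) (by norm_num)
    (by rintro rfl; exact absurd (hpf.trans hf30) (by norm_num)) hpf hp5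
    (by norm_num) a b hb (by rw [← hab]; ring_nf)
  · intro p hp3 hp
    interval_cases p
    · exact absurd hp (by norm_num)
    · exact absurd hp (by norm_num)
    · exact Or.inr (Or.inr ⟨5, 1, by norm_num⟩)
    · exact Or.inr (Or.inr ⟨0, 1, by norm_num⟩)
  · intro l hl
    rcases hpf' l hl with rfl | rfl | rfl
    · exact Or.inr ⟨h2, by norm_num⟩
    · exact Or.inr ⟨h3, by norm_num⟩
    · exact Or.inr ⟨h5, by norm_num⟩
  · intro l hl
    rcases hpf' l hl with rfl | rfl | rfl <;> exact representsUnits_of_forall_zmod B _ _ (by decide)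
  · intro k hk l hl hkl
    rcases hpf' k hk with rfl | rfl | rfl <;> rcases hpf' l hl with rfl | rfl | rfl <;>
      first | exact absurd rfl hkl | decide

theorem isPrime_of_discr_eightyfive (B : QuadraticBasis (𝓞 K) 1 21) :
    IsInertPrime K 2 ∧ IsRamifiedPrime K 5 :=
  ⟨isInertPrime_of_forall_zmod B Nat.prime_two (by decide),
    isRamifiedPrime_of_eq B Nat.prime_five (r := 3) (s := -1) (n := 6) (by norm_num) (by norm_num)
      (by norm_num)⟩

theorem isPrime_of_discr_forty (B : QuadraticBasis (𝓞 K) 0 10) :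
    IsInertPrime K 7 ∧ IsRamifiedPrime K 5 :=
  ⟨isInertPrime_of_forall_zmod B (by norm_num) (by decide),
    isRamifiedPrime_of_eq B Nat.prime_five (r := 0) (s := 0) (n := 2) (by norm_num) (by norm_num)
      (by norm_num)⟩

theorem isPrime_of_discr_sixtyfive (B : QuadraticBasis (𝓞 K) 1 16) :
    IsInertPrime K 3 ∧ IsRamifiedPrime K 5 ∧ IsRamifiedPrime K 13 :=
  ⟨isInertPrime_of_forall_zmod B Nat.prime_three (by decide),
    isRamifiedPrime_of_eq B Nat.prime_five (r := 3) (s := -1) (n := 5) (by norm_num) (by norm_num)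
      (by norm_num),
    isRamifiedPrime_of_eq B (by norm_num) (r := 7) (s := -1) (n := 5) (by norm_num) (by norm_num)
      (by norm_num)⟩

theorem isPrime_of_discr_threehundredsixtyfive (B : QuadraticBasis (𝓞 K) 1 91) :
    IsInertPrime K 2 ∧ IsInertPrime K 3 ∧ IsRamifiedPrime K 5 :=
  ⟨isInertPrime_of_forall_zmod B Nat.prime_two (by decide),
    isInertPrime_of_forall_zmod B Nat.prime_three (by decide),
    isRamifiedPrime_of_eq B Nat.prime_five (r := 3) (s := -1) (n := 20) (by norm_num) (by norm_num)
      (by norm_num)⟩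

theorem isLeast_of_discr_eightyfive (hK : Module.finrank ℚ K = 2)
    (B : QuadraticBasis (𝓞 K) 1 21) {O : Subring (𝓞 K)}
    (hf : orderConductor O = Ideal.span {((10 : ℕ) : 𝓞 K)}) :
    IsLeast (distancesOfDomain O) 2 := by
  obtain ⟨h2, h5⟩ := isPrime_of_discr_eightyfive B
  have hpf : ∀ l ∈ (10 : ℕ).primeFactors, l = 2 ∨ l = 5 := fun l hl ↦
    mem_pair_of_prime_dvd_mul Nat.prime_two Nat.prime_five
      (Nat.prime_of_mem_primeFactors hl) (Nat.dvd_of_mem_primeFactors hl)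
  -- For an inert `p` the group of units modulo `p` up to integers has order `p + 1`, so 2
  -- contributes 3 and the ramified 5 contributes 5.
  refine isLeast_distancesOfDomain_two_of_representsUnits B (e := 17) (by norm_num) (by norm_num)
    hf (squarefree_mul_of_ne Nat.prime_two Nat.prime_five (by norm_num))
    (isPrincipal_mul_of_isRamifiedPrime_five B hK (N := 4) (by norm_num) (by norm_num) h5 ?_)
    ?_ 4 1 (by norm_num) (fun p ↦ if p = 2 then 3 else p) ?_ ?_ Nat.prime_five Nat.prime_three
    (by norm_num) (by norm_num) (by norm_num) (by norm_num) 45 10 (by norm_num) (by norm_num)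
  · intro p hp3 hp
    interval_cases p
    · exact absurd hp (by norm_num)
    · exact absurd hp (by norm_num)
    · exact Or.inr (Or.inl h2)
    · exact Or.inr (Or.inr ⟨2, 1, by norm_num⟩)
    · exact absurd hp (by norm_num)
  · intro l hl
    rcases hpf l hl with rfl | rfl
    · exact Or.inl h2
    · exact Or.inr ⟨h5, by norm_num⟩
  · intro l hl
    rcases hpf l hl with rfl | rfl <;> exact representsUnits_of_forall_zmod B _ _ (by decide)
  · intro k hk l hl hkl
    rcases hpf k hk with rfl | rfl <;> rcases hpf l hl with rfl | rfl <;>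
      first | exact absurd rfl hkl | decide

theorem isLeast_of_discr_forty (hK : Module.finrank ℚ K = 2)
    (B : QuadraticBasis (𝓞 K) 0 10) {O : Subring (𝓞 K)}
    (hf : orderConductor O = Ideal.span {((35 : ℕ) : 𝓞 K)}) :
    IsLeast (distancesOfDomain O) 2 := by
  obtain ⟨h7, h5⟩ := isPrime_of_discr_forty B
  have hp7 : Nat.Prime 7 := by norm_num
  have hpf : ∀ l ∈ (35 : ℕ).primeFactors, l = 7 ∨ l = 5 := fun l hl ↦
    mem_pair_of_prime_dvd_mul hp7 Nat.prime_five
      (Nat.prime_of_mem_primeFactors hl) (Nat.dvd_of_mem_primeFactors hl)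
  -- The element of norm 375 is, up to conjugation, a unit multiple of `25 + 5 √10`; the unit makes
  -- the second coordinate divisible by 7 as well as by 5.
  refine isLeast_distancesOfDomain_two_of_representsUnits B (e := 8) (by norm_num) (by norm_num)
    hf (squarefree_mul_of_ne hp7 Nat.prime_five (by norm_num))
    (isPrincipal_mul_of_isRamifiedPrime_five B hK (N := 3) (by norm_num) (by norm_num) h5 ?_)
    ?_ 3 1 (by norm_num) (fun p ↦ if p = 7 then 8 else p) ?_ ?_ Nat.prime_five Nat.prime_three
    (by norm_num) (by norm_num) (by norm_num) (by norm_num) (-251575) (-79555) (by norm_num)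
    (by norm_num)
  · intro p hp3 hp
    interval_cases p
    · exact absurd hp (by norm_num)
    · exact absurd hp (by norm_num)
    · exact Or.inr (Or.inr ⟨0, 1, by norm_num⟩)
    · exact Or.inr (Or.inr ⟨5, 1, by norm_num⟩)
  · intro l hl
    rcases hpf l hl with rfl | rfl
    · exact Or.inl h7
    · exact Or.inr ⟨h5, by norm_num⟩
  · intro l hl
    rcases hpf l hl with rfl | rfl <;>
      exact representsUnits_of_forall_zmod B _ _ (by decide +kernel)
  · intro k hk l hl hkl
    rcases hpf k hk with rfl | rfl <;> rcases hpf l hl with rfl | rfl <;>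
      first | exact absurd rfl hkl | decide

theorem isLeast_of_discr_sixtyfive (hK : Module.finrank ℚ K = 2)
    (B : QuadraticBasis (𝓞 K) 1 16) {O : Subring (𝓞 K)}
    (hf : orderConductor O = Ideal.span {((195 : ℕ) : 𝓞 K)}) :
    IsLeast (distancesOfDomain O) 2 := by
  obtain ⟨h3, h5, h13⟩ := isPrime_of_discr_sixtyfive B
  have hp13 : Nat.Prime 13 := by norm_num
  have hpf : ∀ l ∈ (195 : ℕ).primeFactors, l = 3 ∨ l = 5 ∨ l = 13 := fun l hl ↦
    mem_triple_of_prime_dvd_mul Nat.prime_three Nat.prime_five hp13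
      (Nat.prime_of_mem_primeFactors hl) (Nat.dvd_of_mem_primeFactors hl)
  -- The orders are 4, 5 and 13. The last two integers are the coordinates of an element of norm `±
  -- 13 ^ 3 * 2` whose second coordinate is divisible by 195.
  refine isLeast_distancesOfDomain_two_of_representsUnits B (e := 13) (by norm_num) (by norm_num)
    hf (squarefree_mul_mul Nat.prime_three Nat.prime_five hp13
      (by norm_num) (by norm_num) (by norm_num))
    (isPrincipal_mul_of_isRamifiedPrime_five B hK (N := 4) (by norm_num) (by norm_num) h5 ?_)
    ?_ 7 2 (by norm_num) (fun p ↦ if p = 3 then 4 else p) ?_ ?_ hp13 Nat.prime_two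
    (by norm_num) (by norm_num) (by norm_num) (by norm_num) (-258089989558349) (-73089937738545)
    (by norm_num) (by norm_num)
  · intro p hp3 hp
    interval_cases p
    · exact absurd hp (by norm_num)
    · exact absurd hp (by norm_num)
    · exact Or.inr (Or.inr ⟨2, 1, by norm_num⟩)
    · exact Or.inr (Or.inl h3)
    · exact absurd hp (by norm_num)
  · intro l hl
    rcases hpf l hl with rfl | rfl | rfl
    · exact Or.inl h3
    · exact Or.inr ⟨h5, by norm_num⟩
    · exact Or.inr ⟨h13, by norm_num⟩
  · intro l hl
    rcases hpf l hl with rfl | rfl | rfl <;>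
      exact representsUnits_of_forall_zmod B _ _ (by decide +kernel)
  · intro k hk l hl hkl
    rcases hpf k hk with rfl | rfl | rfl <;> rcases hpf l hl with rfl | rfl | rfl <;>
      first | exact absurd rfl hkl | decide

theorem isLeast_of_discr_threehundredsixtyfive (hK : Module.finrank ℚ K = 2)
    (B : QuadraticBasis (𝓞 K) 1 91) {O : Subring (𝓞 K)}
    (hf : orderConductor O = Ideal.span {((30 : ℕ) : 𝓞 K)}) :
    IsLeast (distancesOfDomain O) 2 := by
  obtain ⟨h2, h3, h5⟩ := isPrime_of_discr_threehundredsixtyfive B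
  have hpf : ∀ l ∈ (30 : ℕ).primeFactors, l = 2 ∨ l = 3 ∨ l = 5 := fun l hl ↦
    mem_triple_of_prime_dvd_mul Nat.prime_two Nat.prime_three Nat.prime_five
      (Nat.prime_of_mem_primeFactors hl) (Nat.dvd_of_mem_primeFactors hl)
  -- The orders are 3 and 4 for the inert primes 2 and 3, and 5 for the ramified prime 5. The last
  -- two integers give an element of norm `± 5 ^ 3 * 7`.
  refine isLeast_distancesOfDomain_two_of_representsUnits B (e := 73) (by norm_num) (by norm_num)
    hf (squarefree_mul_mul Nat.prime_two Nat.prime_three Nat.prime_five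
      (by norm_num) (by norm_num) (by norm_num))
    (isPrincipal_mul_of_isRamifiedPrime_five B hK (N := 9) (by norm_num) (by norm_num) h5 ?_)
    ?_ 9 1 (by norm_num) (fun p ↦ if p = 5 then 5 else p + 1) ?_ ?_ Nat.prime_five
    (q := 7) (by norm_num) (by norm_num) (by norm_num) (by norm_num) (by norm_num)
    30647032963915 3385482283620 (by norm_num) (by norm_num)
  · intro p hp3 hp
    interval_cases p
    · exact absurd hp (by norm_num)
    · exact absurd hp (by norm_num)
    · exact Or.inr (Or.inl h2)
    · exact Or.inr (Or.inl h3)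
    · exact absurd hp (by norm_num)
    · exact Or.inl rfl
    · exact absurd hp (by norm_num)
    · exact Or.inr (Or.inr ⟨7, 1, by norm_num⟩)
    · exact absurd hp (by norm_num)
    · exact absurd hp (by norm_num)
  · intro l hl
    rcases hpf l hl with rfl | rfl | rfl
    · exact Or.inl h2
    · exact Or.inl h3
    · exact Or.inr ⟨h5, by norm_num⟩
  · intro l hl
    rcases hpf l hl with rfl | rfl | rfl <;>
      exact representsUnits_of_forall_zmod B _ _ (by decide)
  · intro k hk l hl hkl
    rcases hpf k hk with rfl | rfl | rfl <;> rcases hpf l hl with rfl | rfl | rfl <;>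
      first | exact absurd rfl hkl | decide

end QuadOrder

theorem mainTheorem7 (K : Type*) [Field K] [NumberField K] (hK : Module.finrank ℚ K = 2)
    (f : ℕ) (O : Subring (𝓞 K)) (hO : QuadOrder.IsOrder O)
    (hf : QuadOrder.orderConductor O = Ideal.span {(f : 𝓞 K)})
    (hmem : (f, NumberField.discr K) ∈
      ({(2, 60), (3, 60), (5, 60), (6, 60), (10, 60), (15, 60), (30, 60),
        (10, 85), (35, 40), (195, 65), (30, 365)} : Set (ℕ × ℤ))) :
    ((f, NumberField.discr K) ∈ ({(2, 60), (3, 60), (5, 60)} : Set (ℕ × ℤ)) →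
      QuadOrder.IsRamifiedPrime K f) ∧
    ((f, NumberField.discr K) ∈ ({(6, 60), (10, 60), (15, 60)} : Set (ℕ × ℤ)) →
      ∃ p q : ℕ, QuadOrder.IsRamifiedPrime K p ∧ QuadOrder.IsRamifiedPrime K q ∧
        p ≠ q ∧ f = p * q) ∧
    ((f, NumberField.discr K) = ((30, 60) : ℕ × ℤ) →
      ∃ p q r : ℕ, QuadOrder.IsRamifiedPrime K p ∧ QuadOrder.IsRamifiedPrime K q ∧
        QuadOrder.IsRamifiedPrime K r ∧ p ≠ q ∧ p ≠ r ∧ q ≠ r ∧ f = p * q * r) ∧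
    ((f, NumberField.discr K) ∈ ({(10, 85), (35, 40)} : Set (ℕ × ℤ)) →
      ∃ p q : ℕ, QuadOrder.IsInertPrime K p ∧ QuadOrder.IsRamifiedPrime K q ∧ f = p * q) ∧
    ((f, NumberField.discr K) = ((195, 65) : ℕ × ℤ) →
      ∃ p q r : ℕ, QuadOrder.IsInertPrime K p ∧ QuadOrder.IsRamifiedPrime K q ∧
        QuadOrder.IsRamifiedPrime K r ∧ q ≠ r ∧ f = p * q * r) ∧
    ((f, NumberField.discr K) = ((30, 365) : ℕ × ℤ) →
      ∃ p q r : ℕ, QuadOrder.IsInertPrime K p ∧ QuadOrder.IsInertPrime K q ∧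
        QuadOrder.IsRamifiedPrime K r ∧ p ≠ q ∧ f = p * q * r) ∧
    IsLeast (QuadOrder.distancesOfDomain O) 2 := by
  have B60 : NumberField.discr K = 60 → Nonempty (QuadOrder.QuadraticBasis (𝓞 K) 0 15) :=
    fun h ↦ QuadOrder.QuadraticBasis.exists_of_discr hK (by rw [h]; norm_num)
  have B85 : NumberField.discr K = 85 → Nonempty (QuadOrder.QuadraticBasis (𝓞 K) 1 21) :=
    fun h ↦ QuadOrder.QuadraticBasis.exists_of_discr hK (by rw [h]; norm_num)
  have B40 : NumberField.discr K = 40 → Nonempty (QuadOrder.QuadraticBasis (𝓞 K) 0 10) :=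
    fun h ↦ QuadOrder.QuadraticBasis.exists_of_discr hK (by rw [h]; norm_num)
  have B65 : NumberField.discr K = 65 → Nonempty (QuadOrder.QuadraticBasis (𝓞 K) 1 16) :=
    fun h ↦ QuadOrder.QuadraticBasis.exists_of_discr hK (by rw [h]; norm_num)
  have B365 : NumberField.discr K = 365 → Nonempty (QuadOrder.QuadraticBasis (𝓞 K) 1 91) :=
    fun h ↦ QuadOrder.QuadraticBasis.exists_of_discr hK (by rw [h]; norm_num)
  simp only [Set.mem_insert_iff, Set.mem_singleton_iff, Prod.mk.injEq] at hmem ⊢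
  refine ⟨fun h ↦ ?_, fun h ↦ ?_, fun h ↦ ?_, fun h ↦ ?_, fun h ↦ ?_, fun h ↦ ?_, ?_⟩
  · rcases h with ⟨rfl, hd⟩ | ⟨rfl, hd⟩ | ⟨rfl, hd⟩ <;> obtain ⟨B⟩ := B60 hd <;>
      obtain ⟨h2, h3, h5⟩ := QuadOrder.isRamifiedPrime_of_discr_sixty B <;> assumption
  · rcases h with ⟨rfl, hd⟩ | ⟨rfl, hd⟩ | ⟨rfl, hd⟩ <;> obtain ⟨B⟩ := B60 hd <;>
      obtain ⟨h2, h3, h5⟩ := QuadOrder.isRamifiedPrime_of_discr_sixty B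
    · exact ⟨2, 3, h2, h3, by norm_num⟩
    · exact ⟨2, 5, h2, h5, by norm_num⟩
    · exact ⟨3, 5, h3, h5, by norm_num⟩
  · obtain ⟨rfl, hd⟩ := h
    obtain ⟨B⟩ := B60 hd
    obtain ⟨h2, h3, h5⟩ := QuadOrder.isRamifiedPrime_of_discr_sixty B
    exact ⟨2, 3, 5, h2, h3, h5, by norm_num⟩
  · rcases h with ⟨rfl, hd⟩ | ⟨rfl, hd⟩
    · obtain ⟨B⟩ := B85 hd
      obtain ⟨h2, h5⟩ := QuadOrder.isPrime_of_discr_eightyfive B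
      exact ⟨2, 5, h2, h5, by norm_num⟩
    · obtain ⟨B⟩ := B40 hd
      obtain ⟨h7, h5⟩ := QuadOrder.isPrime_of_discr_forty B
      exact ⟨7, 5, h7, h5, by norm_num⟩
  · obtain ⟨rfl, hd⟩ := h
    obtain ⟨B⟩ := B65 hd
    obtain ⟨h3, h5, h13⟩ := QuadOrder.isPrime_of_discr_sixtyfive B
    exact ⟨3, 5, 13, h3, h5, h13, by norm_num⟩
  · obtain ⟨rfl, hd⟩ := h
    obtain ⟨B⟩ := B365 hd
    obtain ⟨h2, h3, h5⟩ := QuadOrder.isPrime_of_discr_threehundredsixtyfive B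
    exact ⟨2, 3, 5, h2, h3, h5, by norm_num⟩
  -- For discriminant 60 the witnesses have norm `-56`, `189` or `-875`. For `f = 6` and `f = 30`
  -- they are `-2 + 2 √15` times the first and fifth power of `4 + √15`, and for `f = 15` it is `-25
  -- + 10 √15` times `4 + √15`.
  · rcases hmem with ⟨rfl, hd⟩ | ⟨rfl, hd⟩ | ⟨rfl, hd⟩ | ⟨rfl, hd⟩ | ⟨rfl, hd⟩ | ⟨rfl, hd⟩ |
      ⟨rfl, hd⟩ | ⟨rfl, hd⟩ | ⟨rfl, hd⟩ | ⟨rfl, hd⟩ | ⟨rfl, hd⟩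
    · obtain ⟨B⟩ := B60 hd
      exact QuadOrder.isLeast_of_discr_sixty hK B hf (by norm_num) Nat.prime_two (by norm_num)
        (by norm_num) (-2) 2 (by norm_num) (by norm_num)
    · obtain ⟨B⟩ := B60 hd
      exact QuadOrder.isLeast_of_discr_sixty hK B hf (by norm_num) Nat.prime_three (by norm_num)
        (by norm_num) (-18) 3 (by norm_num) (by norm_num)
    · obtain ⟨B⟩ := B60 hd
      exact QuadOrder.isLeast_of_discr_sixty hK B hf (by norm_num) Nat.prime_five (by norm_num)
        (by norm_num) (-25) 10 (by norm_num) (by norm_num)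
    · obtain ⟨B⟩ := B60 hd
      exact QuadOrder.isLeast_of_discr_sixty hK B hf (by norm_num) Nat.prime_two (by norm_num)
        (by norm_num) 22 6 (by norm_num) (by norm_num)
    · obtain ⟨B⟩ := B60 hd
      exact QuadOrder.isLeast_of_discr_sixty hK B hf (by norm_num) Nat.prime_five (by norm_num)
        (by norm_num) (-25) 10 (by norm_num) (by norm_num)
    · obtain ⟨B⟩ := B60 hd
      exact QuadOrder.isLeast_of_discr_sixty hK B hf (by norm_num) Nat.prime_five (by norm_num)
        (by norm_num) 50 15 (by norm_num) (by norm_num)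
    · obtain ⟨B⟩ := B60 hd
      exact QuadOrder.isLeast_of_discr_sixty hK B hf (by norm_num) Nat.prime_two (by norm_num)
        (by norm_num) 11038 2850 (by norm_num) (by norm_num)
    · obtain ⟨B⟩ := B85 hd
      exact QuadOrder.isLeast_of_discr_eightyfive hK B hf
    · obtain ⟨B⟩ := B40 hd
      exact QuadOrder.isLeast_of_discr_forty hK B hf
    · obtain ⟨B⟩ := B65 hd
      exact QuadOrder.isLeast_of_discr_sixtyfive hK B hf
    · obtain ⟨B⟩ := B365 hd
      exact QuadOrder.isLeast_of_discr_threehundredsixtyfive hK B hf
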